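/- Let $X=(X_t)_{t\in\mathbb Z}$ be a stationary and ergodic process with values in $\mathbb R^d$, defined on a probability space $(\Omega,\mathcal A,\mathbb P)$, with $\mathbb E\log_+|X_0|<\infty$. Let $\alpha\in\mathbb R$, $\gamma\in\mathbb R^d$, let $F:\mathbb R\to[0,1]$ be a cumulative distribution function that is Lipschitz and positive everywhere, and let $g:\mathbb R\to\mathbb R$ satisfy $|g(s)-g(s')|\le\kappa|s-s'|$ for all $s,s'\in\mathbb R$, for some $\kappa\in(0,1)$. Consider processes $Y=(Y_t)_{t\in\mathbb Z}$ with values in $\{0,1\}$ and real processes $\lambda=(\lambda_t)_{t\in\mathbb Z}$ such that, almost surely for every $t\in\mathbb Z$, $$\mathbb P\left(Y_t=1\mid Y_{t-1},Y_{t-2},\ldots;\,X\right)=F(\lambda_t),\qquad \lambda_t=g(\lambda_{t-1})+\alpha Y_{t-1}+\gamma'X_t .\qquad(*)$$ (Existence.) There is a probability measure on $\{0,1\}^{\mathbb Z}\times\Omega$ whose marginal on $\Omega$ is $\mathbb P$ and such that, with $Y_t(y,\omega)=y_t$, $X_t(y,\omega)=X_t(\omega)$ and a suitable process $\lambda$ on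 this space, $(*)$ holds, the process $((X_t,Y_t,\lambda_t))_{t\in\mathbb Z}$ is stationary, and the process $((X_t,Y_t))_{t\in\mathbb Z}$ is stationary and ergodic. (Uniqueness.) If $(X',Y',\lambda')$ is defined on any probability space and satisfies $(*)$, if $X'$ has the same law as $X$, and if $((X'_t,Y'_t))_{t\in\mathbb Z}$ is stationary or $(\lambda'_t)_{t\in\mathbb Z}$ is stationary, then $((X'_t,Y'_t))_{t\in\mathbb Z}$ has the same law as $((X_t,Y_t))_{t\in\mathbb Z}$ above. -/

import Mathlib

open MeasureTheory ProbabilityTheory Filter Topology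

namespace BinaryAR

/-- The left shift on two-sided sequences: `(x_t)_{t ∈ ℤ} ↦ (x_{t+1})_{t ∈ ℤ}`. -/
def shift {S : Type*} (x : ℤ → S) : ℤ → S := fun t => x (t + 1)

/-- The law of a two-sided process on the path space `S^ℤ` (with its product σ-algebra). -/
noncomputable def pathLaw {Ω S : Type*} [MeasurableSpace Ω] [MeasurableSpace S]
    (Z : ℤ → Ω → S) (P : Measure Ω) : Measure (ℤ → S) :=
  P.map (fun ω t => Z t ω)

/-- A two-sided process is (strictly) stationary: its law is invariant under the shift. -/
structure IsStationary {Ω S : Type*} [MeasurableSpace Ω] [MeasurableSpace S]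
    (Z : ℤ → Ω → S) (P : Measure Ω) : Prop where
  measurable : ∀ t, Measurable (Z t)
  invariant : MeasurePreserving shift (pathLaw Z P) (pathLaw Z P)

/-- A two-sided process is stationary and ergodic: its law is invariant under the shift, and
every shift-invariant event has probability zero or one. -/
structure IsStationaryErgodic {Ω S : Type*} [MeasurableSpace Ω] [MeasurableSpace S]
    (Z : ℤ → Ω → S) (P : Measure Ω) : Prop where
  measurable : ∀ t, Measurable (Z t)
  ergodic : Ergodic shift (pathLaw Z P)

/-- `F` is the cumulative distribution function of a probability measure on `ℝ`. -/
def IsCDF (F : ℝ → ℝ) : Prop :=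
  ∃ ν : Measure ℝ, IsProbabilityMeasure ν ∧ ∀ s, F s = cdf ν s

/-- The σ-algebra generated by `Y_{t-1}, Y_{t-2}, …` and by the whole process `X`. -/
abbrev info {Ω S : Type*} [MeasurableSpace S] (X : ℤ → Ω → S) (Y : ℤ → Ω → Fin 2) (t : ℤ) :
    MeasurableSpace Ω :=
  (⨆ s : {s : ℤ // s < t}, MeasurableSpace.comap (Y s) inferInstance) ⊔
    ⨆ s : ℤ, MeasurableSpace.comap (X s) inferInstance

/-- The processes `X` (covariate), `Y` (binary response) and `lam` (latent), defined on the
probability space `(Ω, P)`, satisfy the binary model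
`P(Y_t = 1 | Y_{t-1}, Y_{t-2}, …, X) = F(lam_t)`,
`lam_t = g(lam_{t-1}) + α Y_{t-1} + γ' X_t`, for all `t ∈ ℤ`, almost surely. -/
structure IsSolution {d : ℕ} (F g : ℝ → ℝ) (α : ℝ) (γ : EuclideanSpace ℝ (Fin d))
    {Ω : Type*} [MeasurableSpace Ω] (P : Measure Ω)
    (X : ℤ → Ω → EuclideanSpace ℝ (Fin d)) (Y : ℤ → Ω → Fin 2) (lam : ℤ → Ω → ℝ) : Prop where
  measurable_X : ∀ t, Measurable (X t)
  measurable_Y : ∀ t, Measurable (Y t)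
  measurable_lam : ∀ t, Measurable (lam t)
  cond_prob : ∀ t, P[(Y t ⁻¹' {1}).indicator (fun _ => (1 : ℝ)) | info X Y t]
    =ᵐ[P] fun ω => F (lam t ω)
  recursion : ∀ t, ∀ᵐ ω ∂P,
    lam t ω = g (lam (t - 1) ω) + α * ((Y (t - 1) ω : ℕ) : ℝ) + inner ℝ γ (X t ω)

end BinaryAR

/-!
The contraction `g` makes the latent process started in the remote past a function of the
covariates and of the past responses, depending on the response `j` steps back at the rate `κ ^ j`.
The problem becomes that of the laws of binary sequences with prescribed conditional probabilities,
with the covariates fixed. By Poincaré recurrence the remote past contains windows, of any given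
length, on which the latent process is bounded whatever the responses were. On such a window a run
of successes has probability bounded below, after which the total influence of the responses before
the window is small, so the window reduces by a fixed factor the dependence of later responses on
earlier ones. Hence each typical covariate trajectory admits exactly one compatible law of the
responses. A joint law is then determined by its covariate marginal, which gives uniqueness and the
shift invariance; uniqueness also for the restrictions to invariant events gives ergodicity. Any
other solution has a latent process that approaches the one started in the remote past, and
stationarity turns this approach into equality of the conditional probabilities.
-/

namespace BinaryAR

/-- Two-sided binary sequences, the paths of the response process. -/
abbrev BinSeq := ℤ → Fin 2

/-! ### Resampling binary sequences -/

/-- The average of `h` when the coordinate at time `s` is resampled, being `1` with probability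
`q`. -/
def transfer (q : BinSeq → ℝ) (s : ℤ) (h : BinSeq → ℝ) (y : BinSeq) : ℝ :=
  q y * h (Function.update y s 1) + (1 - q y) * h (Function.update y s 0)

/-- The average of `h` when the coordinates at times `s, …, s + n - 1` are resampled in
chronological order: it is the conditional expectation of `h` given the past before time `s`, if
`h` only depends on the past before time `s + n`. -/
def resample (q : ℤ → BinSeq → ℝ) (s : ℤ) : ℕ → (BinSeq → ℝ) → BinSeq → ℝ
  | 0, h => h
  | n + 1, h => transfer (q s) s (resample q (s + 1) n h)

section transfer

variable {q h : BinSeq → ℝ} {s : ℤ}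

lemma update_eq_of_dependsOn (hh : DependsOn h (Set.Iio s))
    (y : BinSeq) (a : Fin 2) : h (Function.update y s a) = h y :=
  hh fun _ hi => Function.update_of_ne (ne_of_lt hi) _ _

lemma abs_transfer_le (hq : ∀ y, q y ∈ Set.Icc (0 : ℝ) 1) {C : ℝ} (hh : ∀ y, |h y| ≤ C)
    (y : BinSeq) : |transfer q s h y| ≤ C :=
  have hmem (a : Fin 2) : h (Function.update y s a) ∈ Set.Icc (-C) C := abs_le.1 (hh _)
  abs_le.2 (convex_Icc (-C) C (hmem 1) (hmem 0) (hq y).1 (sub_nonneg.2 (hq y).2) (by ring))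

lemma dependsOn_transfer (hq : DependsOn q (Set.Iio s)) (hh : DependsOn h (Set.Iic s)) :
    DependsOn (transfer q s h) (Set.Iio s) := by
  intro y y' hy
  have h_update (a : Fin 2) : h (Function.update y s a) = h (Function.update y' s a) := by
    refine hh fun i hi => ?_
    rcases eq_or_ne i s with rfl | hne
    · simp
    · simpa [hne] using hy i (lt_of_le_of_ne hi hne)
  simp only [transfer, hq hy, h_update]

lemma transfer_eq_self (hh : DependsOn h (Set.Iio s)) : transfer q s h = h := by
  funext y
  simp only [transfer, update_eq_of_dependsOn hh]
  ring

lemma abs_transfer_sub_le (hq : ∀ y, q y ∈ Set.Icc (0 : ℝ) 1) {y y' : BinSeq} {e o : ℝ}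
    (ho : ∀ z z', |h z - h z'| ≤ o)
    (he : ∀ a : Fin 2, |h (Function.update y s a) - h (Function.update y' s a)| ≤ e) :
    |transfer q s h y - transfer q s h y'| ≤ (1 - |q y - q y'|) * e + |q y - q y'| * o := by
  wlog hle : q y' ≤ q y generalizing y y'
  · rw [abs_sub_comm, abs_sub_comm (q y)]
    exact this (fun a => (abs_sub_comm _ _).trans_le (he a)) (le_of_not_ge hle)
  -- Couple the two draws: both are `1` with probability `q y'`, both are `0` with probability
  -- `1 - q y`, and they differ with probability `q y - q y'`.
  have coupling : transfer q s h y - transfer q s h y' =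
      q y' * (h (Function.update y s 1) - h (Function.update y' s 1))
        + (1 - q y) * (h (Function.update y s 0) - h (Function.update y' s 0))
        + (q y - q y') * (h (Function.update y s 1) - h (Function.update y' s 0)) := by
    unfold transfer
    ring
  have h_both : 0 ≤ q y' := (hq y').1
  have h_none : 0 ≤ 1 - q y := sub_nonneg.2 (hq y).2
  have h_differ : 0 ≤ q y - q y' := sub_nonneg.2 hle
  calc |transfer q s h y - transfer q s h y'|
      ≤ q y' * e + (1 - q y) * e + (q y - q y') * o := by
        rw [coupling]
        refine (abs_add_three _ _ _).trans ?_
        simp only [abs_mul, abs_of_nonneg h_both, abs_of_nonneg h_none, abs_of_nonneg h_differ]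
        gcongr
        exacts [he 1, he 0, ho _ _]
    _ = (1 - |q y - q y'|) * e + |q y - q y'| * o := by
        rw [abs_of_nonneg h_differ]
        ring

end transfer

section resample

variable {q : ℤ → BinSeq → ℝ} {h : BinSeq → ℝ}

lemma resample_add (s : ℤ) (m n : ℕ) (h : BinSeq → ℝ) :
    resample q s (m + n) h = resample q s m (resample q (s + m) n h) := by
  induction m generalizing s with
  | zero => simp [resample]
  | succ m ih =>
    have e : s + 1 + m = s + (m + 1 : ℕ) := by push_cast; ring
    rw [Nat.add_right_comm, resample, ih, e, resample]

lemma abs_resample_le (hq : ∀ s y, q s y ∈ Set.Icc (0 : ℝ) 1) {C : ℝ} (hh : ∀ y, |h y| ≤ C)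
    (s : ℤ) (n : ℕ) (y : BinSeq) : |resample q s n h y| ≤ C := by
  induction n generalizing s y with
  | zero => exact hh y
  | succ n ih => exact abs_transfer_le (hq s) (ih (s + 1)) y

lemma dependsOn_resample (hq : ∀ s, DependsOn (q s) (Set.Iio s)) {s : ℤ} {n : ℕ}
    (hh : DependsOn h (Set.Iio (s + n))) : DependsOn (resample q s n h) (Set.Iio s) := by
  induction n generalizing s with
  | zero => simpa [resample] using hh
  | succ n ih =>
    refine dependsOn_transfer (hq s) ?_
    rw [← Set.Iio_add_one_eq_Iic]
    exact ih (hh.mono (Set.Iio_subset_Iio (by push_cast; omega)))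

lemma resample_eq_self {s : ℤ} (hh : DependsOn h (Set.Iio s)) (n : ℕ) :
    resample q s n h = h := by
  induction n generalizing s with
  | zero => rfl
  | succ n ih =>
    rw [resample, ih (hh.mono (Set.Iio_subset_Iio (by omega))), transfer_eq_self hh]

end resample

/-! ### Forgetting the initial condition -/

/-- Sequences that agree on `I` have `h`-values at distance at most `e`; for `I = ∅`, the
oscillation of `h` is at most `e`. -/
def OscLE (I : Set ℤ) (h : BinSeq → ℝ) (e : ℝ) : Prop :=
  ∀ y y', (∀ i ∈ I, y i = y' i) → |h y - h y'| ≤ e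

/-- From time `s` on, the conditional probabilities depend on the past before `s` at a geometric
rate. The normalization makes `B` the bound on the total influence of that past. -/
def HasGeometricMemory (q : ℤ → BinSeq → ℝ) (s : ℤ) (B κ : ℝ) : Prop :=
  ∀ j : ℕ, OscLE (Set.Ico s (s + j)) (q (s + j)) (B * (1 - κ) * κ ^ j)

/-- The conditional law of a finite block does not depend on the remote past. -/
def Forgets (q : ℤ → BinSeq → ℝ) : Prop :=
  ∀ (a t : ℤ) (h : BinSeq → ℝ), (∀ y, |h y| ≤ 1) → DependsOn h (Set.Ico a t) →
    ∀ ε > 0, ∃ n : ℕ, OscLE ∅ (resample q (t - n) n h) ε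

section Oscillation

variable {q : ℤ → BinSeq → ℝ} {h : BinSeq → ℝ} {I : Set ℤ} {e o B κ : ℝ}

lemma OscLE.mono (H : OscLE I h e) {J : Set ℤ} (hIJ : I ⊆ J) {e' : ℝ} (he : e ≤ e') :
    OscLE J h e' :=
  fun y y' hy => (H y y' fun i hi => hy i (hIJ hi)).trans he

lemma OscLE.nonneg (H : OscLE I h e) : 0 ≤ e :=
  (abs_nonneg _).trans (H 0 0 fun _ _ => rfl)

lemma oscLE_zero_of_dependsOn (hh : DependsOn h I) : OscLE I h 0 :=
  fun y y' hy => by rw [hh hy, sub_self, abs_zero]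

lemma oscLE_two_of_abs_le_one (hh : ∀ y, |h y| ≤ 1) : OscLE ∅ h 2 := fun y y' _ =>
  (abs_sub _ _).trans (by linarith [hh y, hh y'])

lemma OscLE.abs_update_sub_le {s r : ℤ} (H : OscLE (Set.Ico s (r + 1)) h e) {y y' : BinSeq}
    (hy : ∀ i ∈ Set.Ico s r, y i = y' i) (a : Fin 2) :
    |h (Function.update y r a) - h (Function.update y' r a)| ≤ e := by
  refine H _ _ fun i hi => ?_
  rcases eq_or_ne i r with rfl | hne
  · simp
  · simpa [hne] using hy i ⟨hi.1, by have := hi.2; omega⟩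

lemma OscLE.transfer {p : BinSeq → ℝ} (hp : ∀ y, p y ∈ Set.Icc (0 : ℝ) 1) (ho : OscLE ∅ h o)
    (s : ℤ) : OscLE ∅ (transfer p s h) o := fun y y' _ => by
  have hosc (z z') : |h z - h z'| ≤ o := ho z z' fun _ => False.elim
  linarith [abs_transfer_sub_le (s := s) (y := y) (y' := y') hp hosc fun _ => hosc _ _]

lemma OscLE.resample (hq : ∀ s y, q s y ∈ Set.Icc (0 : ℝ) 1) (ho : OscLE ∅ h o) (s : ℤ) (n : ℕ) :
    OscLE ∅ (resample q s n h) o := by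
  induction n generalizing s with
  | zero => exact ho
  | succ n ih => exact (ih (s + 1)).transfer (hq s) s

lemma OscLE.transfer_of_oscLE {p : BinSeq → ℝ} (hp : ∀ y, p y ∈ Set.Icc (0 : ℝ) 1) {s r : ℤ}
    {δ : ℝ} (H : OscLE (Set.Ico s (r + 1)) h e) (ho : OscLE ∅ h o) (hδ : OscLE (Set.Ico s r) p δ) :
    OscLE (Set.Ico s r) (BinaryAR.transfer p r h) (e + δ * o) := by
  intro y y' hy
  have hle := abs_transfer_sub_le hp (fun z z' => ho z z' fun _ => False.elim)
    (H.abs_update_sub_le hy)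
  nlinarith [mul_le_mul_of_nonneg_right (hδ y y' hy) ho.nonneg,
    mul_nonneg (abs_nonneg (p y - p y')) H.nonneg]

lemma OscLE.transfer_of_le {p : BinSeq → ℝ} (hp : ∀ y, p y ∈ Set.Icc (0 : ℝ) 1) {s r : ℤ} {c : ℝ}
    (H : OscLE (Set.Ico s (r + 1)) h e) (ho : OscLE ∅ h o) (heo : e ≤ o) (hc : ∀ y, c ≤ p y) :
    OscLE (Set.Ico s r) (BinaryAR.transfer p r h) (c * e + (1 - c) * o) := by
  intro y y' hy
  have hle := abs_transfer_sub_le hp (fun z z' => ho z z' fun _ => False.elim)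
    (H.abs_update_sub_le hy)
  have hdist : |p y - p y'| ≤ 1 - c :=
    abs_sub_le_iff.2 ⟨by linarith [hc y', (hp y).2], by linarith [hc y, (hp y').2]⟩
  nlinarith [mul_le_mul_of_nonneg_right hdist (sub_nonneg.2 heo)]

lemma HasGeometricMemory.oscLE_resample {s : ℤ} (hD : HasGeometricMemory q s B κ)
    (hq : ∀ s y, q s y ∈ Set.Icc (0 : ℝ) 1) (hB : 0 ≤ B) (hκ : 0 ≤ κ) {j n : ℕ}
    (H : OscLE (Set.Ico s (s + j + n)) h e) (ho : OscLE ∅ h o) :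
    OscLE (Set.Ico s (s + j)) (resample q (s + j) n h) (e + B * κ ^ j * o) := by
  induction n generalizing j with
  | zero =>
    have := ho.nonneg
    exact H.mono (by simp) (le_add_of_nonneg_right (by positivity))
  | succ n ih =>
    have e_time : s + (j + 1 : ℕ) = s + j + 1 := by push_cast; ring
    have hrest := ih (j := j + 1) (H.mono (Set.Ico_subset_Ico_right (by push_cast; omega)) le_rfl)
    rw [e_time] at hrest
    refine (hrest.transfer_of_oscLE (hq _) (ho.resample hq _ n) (hD j)).mono le_rfl (le_of_eq ?_)
    ring

lemma oscLE_resample_of_le (hq : ∀ s y, q s y ∈ Set.Icc (0 : ℝ) 1) {c : ℝ} (hc₀ : 0 ≤ c) {s : ℤ}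
    {j n : ℕ} (hc : ∀ i < j + n, ∀ y, c ≤ q (s + i) y) (H : OscLE (Set.Ico s (s + j + n)) h e)
    (ho : OscLE ∅ h o) (heo : e ≤ o) :
    OscLE (Set.Ico s (s + j)) (resample q (s + j) n h) (o - c ^ n * (o - e)) := by
  induction n generalizing j with
  | zero => simpa [resample] using H
  | succ n ih =>
    have e_time : s + (j + 1 : ℕ) = s + j + 1 := by push_cast; ring
    have hrest := ih (j := j + 1) (fun i hi => hc i (by omega))
      (H.mono (Set.Ico_subset_Ico_right (by push_cast; omega)) le_rfl)
    rw [e_time] at hrest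
    have hle : o - c ^ n * (o - e) ≤ o :=
      sub_le_self _ (mul_nonneg (pow_nonneg hc₀ n) (sub_nonneg.2 heo))
    refine (hrest.transfer_of_le (hq _) (ho.resample hq _ n) hle (hc j (by omega))).mono le_rfl
      (le_of_eq ?_)
    ring

end Oscillation

section Forgets

variable {q : ℤ → BinSeq → ℝ} {h : BinSeq → ℝ} {B κ c : ℝ} {N : ℕ} {a t : ℤ}

lemma exists_oscLE_resample_mul (hq : ∀ s y, q s y ∈ Set.Icc (0 : ℝ) 1) (hB : 0 ≤ B)
    (hκ₀ : 0 ≤ κ) (hκ₁ : κ < 1) (hN : B * κ ^ N ≤ 1 / 2) (hc : 0 ≤ c)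
    (hrec : ∀ s₀ : ℤ, ∃ s ≤ s₀, HasGeometricMemory q s B κ ∧ ∀ j < N, ∀ y, c ≤ q (s + j) y)
    (hh : ∀ y, |h y| ≤ 1) (hd : DependsOn h (Set.Ico a t)) {n : ℕ} {o : ℝ} (ho₀ : 0 < o)
    (ho : OscLE ∅ (resample q (t - n) n h) o) :
    ∃ m : ℕ, OscLE ∅ (resample q (t - m) m h) ((1 - c ^ N / 4) * o) := by
  obtain ⟨L, hLN, hL⟩ : ∃ L, N ≤ L ∧ B * κ ^ L * 2 ≤ o / 4 := by
    have hlim : Tendsto (fun L : ℕ => B * κ ^ L * 2) atTop (𝓝 (B * 0 * 2)) :=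
      ((tendsto_pow_atTop_nhds_zero_of_lt_one hκ₀ hκ₁).const_mul B).mul_const 2
    exact ((eventually_ge_atTop N).and
      (hlim.eventually_le_const (by simpa using ho₀))).exists
  obtain ⟨s, hs, hD, hcs⟩ := hrec (min a (t - n - L))
  obtain ⟨hsa, hst⟩ := le_min_iff.1 hs
  obtain ⟨l, hl⟩ : ∃ l : ℕ, t = s + L + l + n := ⟨(t - n - L - s).toNat, by omega⟩
  -- Read backwards in time: `l + n` steps make the function nearly local on `[s, s + L)`, the next
  -- `L - N` steps keep it so on `[s, s + N)`, and the last `N` steps erase part of that window.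
  have h_far : OscLE (Set.Ico s (s + L)) (resample q (s + L) (l + n) h) (o / 4) :=
    (hD.oscLE_resample hq hB hκ₀ ((oscLE_zero_of_dependsOn hd).mono
      (Set.Ico_subset_Ico hsa (by push_cast; omega)) le_rfl) (oscLE_two_of_abs_le_one hh)).mono
      le_rfl (by linarith)
  have h_osc : OscLE ∅ (resample q (s + L) (l + n) h) o := by
    rw [resample_add, show s + L + l = t - n by omega]
    exact ho.resample hq _ l
  have e_time : s + N + (L - N : ℕ) = s + L := by omega
  have h_mid : OscLE (Set.Ico s (s + N)) (resample q (s + N) (L - N + (l + n)) h) (3 / 4 * o) := by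
    rw [← e_time] at h_far h_osc
    rw [resample_add]
    exact (hD.oscLE_resample hq hB hκ₀ h_far h_osc).mono le_rfl (by nlinarith)
  have h_osc_mid : OscLE ∅ (resample q (s + N) (L - N + (l + n)) h) o := by
    rw [resample_add, e_time]
    exact h_osc.resample hq _ _
  have h_near : OscLE (Set.Ico s (s + (0 : ℕ))) (resample q (s + (0 : ℕ)) N
      (resample q (s + N) (L - N + (l + n)) h)) (o - c ^ N * (o - 3 / 4 * o)) :=
    oscLE_resample_of_le hq hc (by simpa using hcs) (by simpa using h_mid) h_osc_mid (by linarith)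
  refine ⟨N + (L - N + (l + n)), ?_⟩
  rw [resample_add, show t - (N + (L - N + (l + n)) : ℕ) = s by push_cast; omega]
  simp only [Nat.cast_zero, add_zero, Set.Ico_self] at h_near
  exact h_near.mono le_rfl (by linarith)

lemma forgets_of_recurrent (hq : ∀ s y, q s y ∈ Set.Icc (0 : ℝ) 1) (hB : 0 ≤ B)
    (hκ₀ : 0 ≤ κ) (hκ₁ : κ < 1) (hN : B * κ ^ N ≤ 1 / 2) (hc : 0 < c)
    (hrec : ∀ s₀ : ℤ, ∃ s ≤ s₀, HasGeometricMemory q s B κ ∧ ∀ j < N, ∀ y, c ≤ q (s + j) y) :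
    Forgets q := by
  intro a t h hh hd ε hε
  have hrate₁ : 1 - c ^ N / 4 < 1 := by linarith [pow_pos hc N]
  have hrate₀ : 0 < 1 - c ^ N / 4 := by
    have hcN : c ^ N ≤ 1 := by
      obtain ⟨s, -, -, hs⟩ := hrec 0
      rcases N.eq_zero_or_pos with rfl | hN₀
      exacts [(pow_zero c).le, pow_le_one₀ hc.le ((hs 0 hN₀ 0).trans (hq _ _).2)]
    linarith
  have h_decay (m : ℕ) : ∃ n : ℕ, OscLE ∅ (resample q (t - n) n h) ((1 - c ^ N / 4) ^ m * 2) := by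
    induction m with
    | zero => exact ⟨0, by simpa [resample] using oscLE_two_of_abs_le_one hh⟩
    | succ m ih =>
      obtain ⟨n, hn⟩ := ih
      rw [pow_succ', mul_assoc]
      exact exists_oscLE_resample_mul hq hB hκ₀ hκ₁ hN hc.le hrec hh hd (by positivity) hn
  have hlim : Tendsto (fun m : ℕ => (1 - c ^ N / 4) ^ m * 2) atTop (𝓝 0) := by
    simpa using (tendsto_pow_atTop_nhds_zero_of_lt_one hrate₀.le hrate₁).mul_const 2
  obtain ⟨m, hm⟩ := (hlim.eventually_le_const hε).exists
  obtain ⟨n, hn⟩ := h_decay m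
  exact ⟨n, hn.mono le_rfl hm⟩

lemma Forgets.eventually (H : Forgets q) (hq : ∀ s y, q s y ∈ Set.Icc (0 : ℝ) 1)
    (hh : ∀ y, |h y| ≤ 1) (hd : DependsOn h (Set.Ico a t)) {ε : ℝ} (hε : 0 < ε) :
    ∀ᶠ n : ℕ in atTop, OscLE ∅ (resample q (t - n) n h) ε := by
  obtain ⟨n, hn⟩ := H a t h hh hd ε hε
  filter_upwards [eventually_ge_atTop n] with m hm
  obtain ⟨j, rfl⟩ := Nat.exists_eq_add_of_le' hm
  rw [resample_add, show t - (j + n : ℕ) + j = t - n by push_cast; ring]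
  exact hn.resample hq _ j

end Forgets

/-! ### Binary sequences with given conditional probabilities -/

section Past

/-- The sequence `y` with the coordinates from time `t` on replaced by zero. -/
def past (t : ℤ) (y : BinSeq) : BinSeq := fun s => if s < t then y s else 0

/-- The response at time `s` as a real number. -/
def isOne (s : ℤ) (y : BinSeq) : ℝ := ((y s : ℕ) : ℝ)

/-- The σ-algebra on `S × {0,1}^ℤ` of the environment and of the binary sequence before time `t`. -/
abbrev pastAlgebra (S : Type*) [MeasurableSpace S] (t : ℤ) : MeasurableSpace (S × BinSeq) :=
  MeasurableSpace.comap (Prod.map id (past t)) inferInstance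

lemma past_apply_of_lt {t s : ℤ} (hst : s < t) (y : BinSeq) : past t y s = y s := if_pos hst

lemma dependsOn_past (t : ℤ) : DependsOn (past t) (Set.Iio t) := by
  intro y y' hy
  funext s
  unfold past
  split_ifs with hst
  exacts [hy s hst, rfl]

lemma past_past {s t : ℤ} (hst : s ≤ t) (y : BinSeq) : past s (past t y) = past s y :=
  dependsOn_past s fun _ hi => past_apply_of_lt (lt_of_lt_of_le hi hst) y

lemma continuous_past (t : ℤ) : Continuous (past t) := by
  refine continuous_pi fun s => ?_
  unfold past
  split_ifs
  exacts [continuous_apply s, continuous_const]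

lemma isOne_mem_Icc (s : ℤ) (y : BinSeq) : isOne s y ∈ Set.Icc (0 : ℝ) 1 :=
  ⟨Nat.cast_nonneg _, Nat.cast_le_one.2 (by omega)⟩

lemma continuous_isOne (s : ℤ) : Continuous (isOne s) :=
  (continuous_of_discreteTopology (f := fun a : Fin 2 => ((a : ℕ) : ℝ))).comp (continuous_apply s)

lemma sub_transfer (q h : BinSeq → ℝ) (s : ℤ) (y : BinSeq) :
    h y - transfer q s h y =
      (h (Function.update y s 1) - h (Function.update y s 0)) * (isOne s y - q y) := by
  have h_self : h (Function.update y s (y s)) = h y := by rw [Function.update_eq_self]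
  unfold transfer isOne
  rcases (by omega : y s = 0 ∨ y s = 1) with hy | hy <;> rw [hy] at h_self ⊢ <;> rw [h_self] <;>
    simp <;> ring

variable {S : Type*} [MeasurableSpace S]

lemma pastAlgebra_le (t : ℤ) : pastAlgebra S t ≤ Prod.instMeasurableSpace :=
  (measurable_id.prodMap (continuous_past t).measurable).comap_le

lemma pastAlgebra_mono : Monotone (pastAlgebra S) := by
  intro s t hst
  have e : Prod.map id (past s) = Prod.map id (past s) ∘ Prod.map (id : S → S) (past t) :=
    funext fun z => Prod.ext rfl (past_past hst z.2).symm
  rw [pastAlgebra, e, ← MeasurableSpace.comap_comp]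
  exact MeasurableSpace.comap_mono
    (measurable_id.prodMap (continuous_past s).measurable).comap_le

lemma measurable_pastAlgebra {β : Type*} [MeasurableSpace β] {t : ℤ} {f : S × BinSeq → β}
    (hf : Measurable f) (hd : ∀ x, DependsOn (fun y => f (x, y)) (Set.Iio t)) :
    Measurable[pastAlgebra S t] f := by
  have e : f = f ∘ Prod.map id (past t) :=
    funext fun z => (hd z.1 fun _ hs => past_apply_of_lt hs z.2).symm
  rw [e]
  exact hf.comp (comap_measurable _)

lemma measurable_fst_pastAlgebra (t : ℤ) :
    Measurable[pastAlgebra S t] (Prod.fst : S × BinSeq → S) :=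
  measurable_pastAlgebra measurable_fst fun _ _ _ _ => rfl

end Past

lemma integral_mul_eq_zero_of_forall_setIntegral_eq_zero {Ω : Type*} {m m₀ : MeasurableSpace Ω}
    (hm : m ≤ m₀) {μ : Measure Ω} [IsFiniteMeasure μ] {φ f : Ω → ℝ} (hφ : Integrable φ μ)
    (hφ₀ : ∀ C, MeasurableSet[m] C → ∫ ω in C, φ ω ∂μ = 0) (hf : StronglyMeasurable[m] f) {c : ℝ}
    (hfc : ∀ ω, |f ω| ≤ c) : ∫ ω, f ω * φ ω ∂μ = 0 := by
  have h_cond : 0 =ᵐ[μ] μ[φ | m] :=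
    ae_eq_condExp_of_forall_setIntegral_eq hm hφ (fun _ _ _ => integrableOn_zero)
      (fun C hC _ => by simp [hφ₀ C hC]) aestronglyMeasurable_zero
  have h_pull : μ[f * φ | m] =ᵐ[μ] f * μ[φ | m] :=
    condExp_stronglyMeasurable_mul_of_bound hm hf hφ c (.of_forall hfc)
  calc ∫ ω, f ω * φ ω ∂μ = ∫ ω, (μ[f * φ | m]) ω ∂μ := (integral_condExp hm).symm
    _ = ∫ _, (0 : ℝ) ∂μ := by
        refine integral_congr_ae ?_
        filter_upwards [h_pull, h_cond] with ω h_pull h_cond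
        simp [h_pull, ← h_cond]
    _ = 0 := integral_zero _ _

/-- A family `p x s y` of conditional probabilities, depending measurably on the environment `x`
and on the past of `y` before the time `s`. -/
structure IsSpecification {S : Type*} [MeasurableSpace S] (p : S → ℤ → BinSeq → ℝ) : Prop where
  mem_Icc : ∀ x s y, p x s y ∈ Set.Icc (0 : ℝ) 1
  measurable : ∀ s, Measurable (fun z : S × BinSeq => p z.1 s z.2)
  dependsOn : ∀ x s, DependsOn (p x s) (Set.Iio s)

/-- The deviation of the response at time `s` from its conditional probability. -/
def innovation {S : Type*} (p : S → ℤ → BinSeq → ℝ) (s : ℤ) (z : S × BinSeq) : ℝ :=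
  isOne s z.2 - p z.1 s z.2

/-- Under `ρ`, given the environment `x` and the past before time `s`, the binary sequence is `1` at
time `s` with probability `p x s`. The condition is stated without conditional expectations so that
it also makes sense for finite measures and is stable under restriction. -/
def IsCompatible {S : Type*} [MeasurableSpace S] (p : S → ℤ → BinSeq → ℝ)
    (ρ : Measure (S × BinSeq)) : Prop :=
  ∀ s C, MeasurableSet[pastAlgebra S s] C → ∫ z in C, innovation p s z ∂ρ = 0

section Specification

variable {S : Type*} [MeasurableSpace S] {p : S → ℤ → BinSeq → ℝ}

lemma measurable_transfer {s : ℤ} {q f : S → BinSeq → ℝ}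
    (hq : Measurable fun z : S × BinSeq => q z.1 z.2)
    (hf : Measurable fun z : S × BinSeq => f z.1 z.2) :
    Measurable fun z : S × BinSeq => transfer (q z.1) s (f z.1) z.2 := by
  have h_update (a : Fin 2) :
      Measurable fun z : S × BinSeq => f z.1 (Function.update z.2 s a) :=
    hf.comp (measurable_fst.prodMk (measurable_update_left.comp measurable_snd))
  exact (hq.mul (h_update 1)).add ((measurable_const.sub hq).mul (h_update 0))

namespace IsSpecification

lemma comp (hp : IsSpecification p) {S' : Type*} [MeasurableSpace S'] {φ : S' → S}
    (hφ : Measurable φ) : IsSpecification fun x => p (φ x) where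
  mem_Icc x := hp.mem_Icc (φ x)
  measurable s := (hp.measurable s).comp (hφ.prodMap measurable_id)
  dependsOn x := hp.dependsOn (φ x)

lemma measurable_resample (hp : IsSpecification p) {h : BinSeq → ℝ} (hm : Measurable h) (s : ℤ)
    (n : ℕ) : Measurable fun z : S × BinSeq => resample (p z.1) s n h z.2 := by
  induction n generalizing s with
  | zero => exact hm.comp measurable_snd
  | succ n ih =>
    exact measurable_transfer (q := fun x => p x s) (f := fun x => resample (p x) (s + 1) n h)
      (hp.measurable s) (ih (s + 1))

lemma abs_innovation_le_one (hp : IsSpecification p) (s : ℤ) (z : S × BinSeq) :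
    |innovation p s z| ≤ 1 :=
  abs_sub_le_of_nonneg_of_le (isOne_mem_Icc s z.2).1 (isOne_mem_Icc s z.2).2
    (hp.mem_Icc z.1 s z.2).1 (hp.mem_Icc z.1 s z.2).2

lemma measurable_innovation (hp : IsSpecification p) (s : ℤ) : Measurable (innovation p s) :=
  ((continuous_isOne s).measurable.comp measurable_snd).sub (hp.measurable s)

lemma integrable_innovation (hp : IsSpecification p) (s : ℤ) (ρ : Measure (S × BinSeq))
    [IsFiniteMeasure ρ] : Integrable (innovation p s) ρ :=
  .of_bound (hp.measurable_innovation s).aestronglyMeasurable 1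
    (.of_forall (hp.abs_innovation_le_one s))

end IsSpecification

namespace IsCompatible

variable {ρ : Measure (S × BinSeq)}

lemma restrict_fst (hρ : IsCompatible p ρ) {B : Set S} (hB : MeasurableSet B) :
    IsCompatible p (ρ.restrict (Prod.fst ⁻¹' B)) := by
  intro s C hC
  rw [Measure.restrict_restrict (pastAlgebra_le s _ hC)]
  exact hρ s _ (hC.inter (measurable_fst_pastAlgebra s hB))

variable [IsFiniteMeasure ρ]

lemma integral_eq_integral_transfer (hρ : IsCompatible p ρ) (hp : IsSpecification p) {s : ℤ}
    {f : S → BinSeq → ℝ} (hf : Measurable fun z : S × BinSeq => f z.1 z.2) {c : ℝ}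
    (hfc : ∀ x y, |f x y| ≤ c) (hd : ∀ x, DependsOn (f x) (Set.Iic s)) :
    ∫ z, f z.1 z.2 ∂ρ = ∫ z, transfer (p z.1 s) s (f z.1) z.2 ∂ρ := by
  have h_update (a : Fin 2) :
      Measurable[pastAlgebra S s] fun z => f z.1 (Function.update z.2 s a) :=
    measurable_pastAlgebra
      (hf.comp (measurable_fst.prodMk (measurable_update_left.comp measurable_snd)))
      fun x y y' hy => hd x fun i hi => by
        rcases eq_or_ne i s with rfl | hne
        · simp
        · simpa [hne] using hy i (lt_of_le_of_ne hi hne)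
  have h_zero := integral_mul_eq_zero_of_forall_setIntegral_eq_zero (pastAlgebra_le s)
    (hp.integrable_innovation s ρ) (hρ s) ((h_update 1).sub (h_update 0)).stronglyMeasurable
    (c := c + c) fun z => (abs_sub _ _).trans (add_le_add (hfc _ _) (hfc _ _))
  rw [← sub_eq_zero, ← integral_sub, ← h_zero]
  · exact integral_congr_ae (.of_forall fun z => sub_transfer (p z.1 s) (f z.1) s z.2)
  · exact .of_bound hf.aestronglyMeasurable c (.of_forall fun z => hfc _ _)
  · exact .of_bound
      (measurable_transfer (q := fun x => p x s) (hp.measurable s) hf).aestronglyMeasurable c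
      (.of_forall fun z => abs_transfer_le (hp.mem_Icc z.1 s) (hfc z.1) z.2)

lemma integral_eq_integral_resample (hρ : IsCompatible p ρ) (hp : IsSpecification p) {s : ℤ} {n : ℕ}
    {h : BinSeq → ℝ} (hm : Measurable h) {c : ℝ} (hh : ∀ y, |h y| ≤ c)
    (hd : DependsOn h (Set.Iio (s + n))) :
    ∫ z, h z.2 ∂ρ = ∫ z, resample (p z.1) s n h z.2 ∂ρ := by
  induction n generalizing s with
  | zero => rfl
  | succ n ih =>
    have hd' : DependsOn h (Set.Iio (s + 1 + n)) :=
      hd.mono (Set.Iio_subset_Iio (by push_cast; omega))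
    rw [ih hd']
    refine hρ.integral_eq_integral_transfer hp (f := fun x => resample (p x) (s + 1) n h)
      (hp.measurable_resample hm _ _) (fun x => abs_resample_le (hp.mem_Icc x) hh _ _) fun x => ?_
    rw [← Set.Iio_add_one_eq_Iic]
    exact dependsOn_resample (hp.dependsOn x) hd'

/-! ### Uniqueness of compatible laws -/

lemma tendsto_integral_resample (hρ : IsCompatible p ρ) (hp : IsSpecification p)
    (hF : ∀ᵐ x ∂ρ.map Prod.fst, Forgets (p x)) {a t : ℤ} {h : BinSeq → ℝ} (hm : Measurable h)
    (hh : ∀ y, |h y| ≤ 1) (hd : DependsOn h (Set.Ico a t)) :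
    Tendsto (fun n : ℕ => ∫ x, resample (p x) (t - n) n h 0 ∂ρ.map Prod.fst) atTop
      (𝓝 (∫ z, h z.2 ∂ρ)) := by
  have hm_resample (n : ℕ) := hp.measurable_resample hm (t - n) n
  have hm_zero (n : ℕ) : Measurable fun x => resample (p x) (t - n) n h 0 :=
    (hm_resample n).comp (measurable_id.prodMk measurable_const)
  have h_bound (x : S) (n : ℕ) := abs_resample_le (hp.mem_Icc x) hh (t - n) n
  have h_diff : Tendsto (fun n : ℕ =>
      ∫ z, (resample (p z.1) (t - n) n h 0 - resample (p z.1) (t - n) n h z.2) ∂ρ) atTop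
      (𝓝 (∫ _, (0 : ℝ) ∂ρ)) := by
    refine tendsto_integral_of_dominated_convergence (fun _ => 1 + 1)
      (fun n => (((hm_zero n).comp measurable_fst).sub (hm_resample n)).aestronglyMeasurable)
      (integrable_const _)
      (fun n => .of_forall fun z =>
        (abs_sub _ _).trans (add_le_add (h_bound _ _ _) (h_bound _ _ _)))
      ?_
    filter_upwards [ae_of_ae_map measurable_fst.aemeasurable hF] with z hz
    refine Metric.tendsto_nhds.2 fun ε hε => ?_
    filter_upwards [hz.eventually (hp.mem_Icc z.1) hh hd (half_pos hε)] with n hn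
    rw [Real.dist_eq, sub_zero]
    exact (hn 0 z.2 fun _ => False.elim).trans_lt (half_lt_self hε)
  have h_split (n : ℕ) : ∫ x, resample (p x) (t - n) n h 0 ∂ρ.map Prod.fst =
      ∫ z, (resample (p z.1) (t - n) n h 0 - resample (p z.1) (t - n) n h z.2) ∂ρ
        + ∫ z, h z.2 ∂ρ := by
    rw [integral_map measurable_fst.aemeasurable (hm_zero n).aestronglyMeasurable,
      hρ.integral_eq_integral_resample hp (s := t - n) (n := n) hm hh
        (by simpa using hd.mono Set.Ico_subset_Iio_self),
      integral_sub, sub_add_cancel]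
    · exact .of_bound ((hm_zero n).comp measurable_fst).aestronglyMeasurable 1
        (.of_forall fun z => h_bound _ _ _)
    · exact .of_bound (hm_resample n).aestronglyMeasurable 1 (.of_forall fun z => h_bound _ _ _)
  simpa [h_split] using h_diff.add_const (∫ z, h z.2 ∂ρ)

end IsCompatible

lemma exists_dependsOn_Ico_of_mem_measurableCylinders {C : Set BinSeq}
    (hC : C ∈ measurableCylinders fun _ : ℤ => Fin 2) :
    ∃ a t : ℤ, DependsOn (C.indicator (1 : BinSeq → ℝ)) (Set.Ico a t) := by
  obtain ⟨I, T, -, rfl⟩ := (mem_measurableCylinders _).1 hC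
  obtain ⟨a, ha⟩ := I.bddBelow
  obtain ⟨b, hb⟩ := I.bddAbove
  refine ⟨a, b + 1, fun y y' hy => ?_⟩
  have h_restrict : I.restrict y = I.restrict y' :=
    funext fun i => hy i ⟨ha i.2, Int.lt_add_one_of_le (hb i.2)⟩
  exact Set.indicator_eq_indicator (by rw [mem_cylinder, mem_cylinder, h_restrict]) rfl

lemma measure_eq_of_forall_measurableCylinders {μ μ' : Measure BinSeq} [IsFiniteMeasure μ]
    (h : ∀ C ∈ measurableCylinders fun _ : ℤ => Fin 2, μ C = μ' C) : μ = μ' :=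
  ext_of_generate_finite _ generateFrom_measurableCylinders.symm isPiSystem_measurableCylinders h
    (h _ (univ_mem_measurableCylinders _))

lemma IsCompatible.map_snd_eq {ρ ρ' : Measure (S × BinSeq)} [IsFiniteMeasure ρ] [IsFiniteMeasure ρ']
    (hρ : IsCompatible p ρ) (hρ' : IsCompatible p ρ') (hp : IsSpecification p)
    (hF : ∀ᵐ x ∂ρ.map Prod.fst, Forgets (p x)) (h_fst : ρ'.map Prod.fst = ρ.map Prod.fst) :
    ρ'.map Prod.snd = ρ.map Prod.snd := by
  refine measure_eq_of_forall_measurableCylinders fun C hC => ?_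
  have hCm : MeasurableSet C := .of_mem_measurableCylinders hC
  obtain ⟨a, t, hd⟩ := exists_dependsOn_Ico_of_mem_measurableCylinders hC
  have hm : Measurable (C.indicator (1 : BinSeq → ℝ)) := measurable_one.indicator hCm
  have hb (y : BinSeq) : |C.indicator (1 : BinSeq → ℝ) y| ≤ 1 := by
    by_cases hy : y ∈ C <;> simp [hy]
  have h_integral : ∫ z, C.indicator (1 : BinSeq → ℝ) z.2 ∂ρ' = ∫ z, C.indicator 1 z.2 ∂ρ :=
    tendsto_nhds_unique
      (h_fst ▸ hρ'.tendsto_integral_resample hp (h_fst ▸ hF) hm hb hd)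
      (hρ.tendsto_integral_resample hp hF hm hb hd)
  rw [← integral_map measurable_snd.aemeasurable hm.aestronglyMeasurable,
    ← integral_map measurable_snd.aemeasurable hm.aestronglyMeasurable,
    integral_indicator_one hCm, integral_indicator_one hCm] at h_integral
  exact (measureReal_eq_measureReal_iff).1 h_integral

theorem IsCompatible.eq_of_map_fst_eq {ρ ρ' : Measure (S × BinSeq)} [IsFiniteMeasure ρ]
    [IsFiniteMeasure ρ'] (hρ : IsCompatible p ρ) (hρ' : IsCompatible p ρ') (hp : IsSpecification p)
    (hF : ∀ᵐ x ∂ρ.map Prod.fst, Forgets (p x)) (h_fst : ρ'.map Prod.fst = ρ.map Prod.fst) :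
    ρ' = ρ := by
  refine Measure.ext_prod fun {B C} hB hC => ?_
  have h_restrict (μ : Measure (S × BinSeq)) :
      (μ.restrict (Prod.fst ⁻¹' B)).map Prod.fst = (μ.map Prod.fst).restrict B :=
    (Measure.restrict_map measurable_fst hB).symm
  have h_snd := (hρ.restrict_fst hB).map_snd_eq (hρ'.restrict_fst hB) hp
    (by rw [h_restrict]; exact ae_restrict_of_ae hF) (by rw [h_restrict, h_restrict, h_fst])
  have h_apply (μ : Measure (S × BinSeq)) :
      (μ.restrict (Prod.fst ⁻¹' B)).map Prod.snd C = μ (B ×ˢ C) := by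
    rw [Measure.map_apply measurable_snd hC, Measure.restrict_apply (measurable_snd hC),
      Set.inter_comm, Set.prod_eq]
  rw [← h_apply, ← h_apply, h_snd]

end Specification

/-! ### Existence of compatible laws -/

/-- Under `μ`, the binary sequence is `1` at time `s` with probability `q s` given the past: this is
`IsCompatible` in a fixed environment. -/
def HasConditionals (q : ℤ → BinSeq → ℝ) (μ : Measure BinSeq) : Prop :=
  ∀ s C, MeasurableSet C → ∫ y in past s ⁻¹' C, (isOne s y - q s y) ∂μ = 0

section Fiber

variable {q : ℤ → BinSeq → ℝ}

lemma integrable_of_continuous {f : BinSeq → ℝ} (hf : Continuous f) (μ : Measure BinSeq)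
    [IsFiniteMeasure μ] : Integrable f μ :=
  (BoundedContinuousFunction.mkOfCompact ⟨f, hf⟩).integrable μ

lemma continuous_indicator_of_mem_measurableCylinders {C : Set BinSeq}
    (hC : C ∈ measurableCylinders fun _ : ℤ => Fin 2) :
    Continuous (C.indicator (1 : BinSeq → ℝ)) := by
  obtain ⟨I, T, -, rfl⟩ := (mem_measurableCylinders _).1 hC
  have h_clopen : IsClopen (cylinder (α := fun _ : ℤ => Fin 2) I T) :=
    (isClopen_discrete T).preimage (continuous_pi fun i => continuous_apply (i : ℤ))
  exact h_clopen.continuous_indicator continuous_one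

lemma transfer_mul_sub_eq_zero {u p : BinSeq → ℝ} {s : ℤ} (hp : DependsOn p (Set.Iio s))
    (hu : DependsOn u (Set.Iio s)) : transfer p s (fun y => u y * (isOne s y - p y)) = 0 := by
  funext y
  simp only [transfer, update_eq_of_dependsOn hp, update_eq_of_dependsOn hu, isOne,
    Function.update_self, Pi.zero_apply]
  norm_num
  ring

lemma resample_eq_zero {f : BinSeq → ℝ} {s r : ℤ} {n : ℕ} (hf : DependsOn f (Set.Iic r))
    (hf₀ : transfer (q r) r f = 0) (hsr : s ≤ r) (hrn : r < s + n) : resample q s n f = 0 := by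
  obtain ⟨j, rfl⟩ : ∃ j : ℕ, r = s + j := ⟨(r - s).toNat, by omega⟩
  obtain ⟨m, rfl⟩ : ∃ m, n = j + (m + 1) := Nat.exists_eq_add_of_lt (by omega)
  rw [← Set.Iio_add_one_eq_Iic] at hf
  rw [resample_add, resample, resample_eq_self hf, hf₀]
  exact resample_eq_self (fun _ _ _ => rfl) j

lemma exists_measure_integral_eq_resample (hq : ∀ s y, q s y ∈ Set.Icc (0 : ℝ) 1) (s : ℤ) (n : ℕ)
    (y : BinSeq) : ∃ μ : ProbabilityMeasure BinSeq,
      ∀ f : BinSeq → ℝ, Continuous f → ∫ z, f z ∂μ = resample q s n f y := by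
  induction n generalizing s y with
  | zero => exact ⟨⟨Measure.dirac y, inferInstance⟩, fun f _ => integral_dirac f y⟩
  | succ n ih =>
    obtain ⟨μ₁, hμ₁⟩ := ih (s + 1) (Function.update y s 1)
    obtain ⟨μ₀, hμ₀⟩ := ih (s + 1) (Function.update y s 0)
    obtain ⟨h_nonneg, h_le⟩ := hq s y
    refine ⟨⟨ENNReal.ofReal (q s y) • (μ₁ : Measure BinSeq) +
      ENNReal.ofReal (1 - q s y) • (μ₀ : Measure BinSeq), ⟨?_⟩⟩, fun f hf => ?_⟩
    · simp only [Measure.coe_add, Measure.coe_smul, Pi.add_apply, Pi.smul_apply, measure_univ,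
        smul_eq_mul, mul_one]
      rw [← ENNReal.ofReal_add h_nonneg (sub_nonneg.2 h_le), add_sub_cancel, ENNReal.ofReal_one]
    · rw [ProbabilityMeasure.coe_mk, integral_add_measure
          ((integrable_of_continuous hf _).smul_measure ENNReal.ofReal_ne_top)
          ((integrable_of_continuous hf _).smul_measure ENNReal.ofReal_ne_top),
        integral_smul_measure, integral_smul_measure, hμ₁ f hf, hμ₀ f hf,
        ENNReal.toReal_ofReal h_nonneg, ENNReal.toReal_ofReal (sub_nonneg.2 h_le)]
      rfl

/-- A limit point of the laws started from the zero sequence at increasingly remote times. -/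
lemma exists_measure_forall_continuous_integral_eq_zero (hq : ∀ s y, q s y ∈ Set.Icc (0 : ℝ) 1)
    (hd : ∀ s, DependsOn (q s) (Set.Iio s)) (hc : ∀ s, Continuous (q s)) :
    ∃ μ : ProbabilityMeasure BinSeq, ∀ (s : ℤ) (u : BinSeq → ℝ), Continuous u →
      DependsOn u (Set.Iio s) → ∫ y, u y * (isOne s y - q s y) ∂μ = 0 := by
  choose ν hν using fun n : ℕ => exists_measure_integral_eq_resample hq (-n) (n + n) 0
  obtain ⟨μ, -, hμ⟩ := isCompact_univ.ultrafilter_le_nhds ((hyperfilter ℕ).map ν) (by simp)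
  refine ⟨μ, fun s u hu hud => ?_⟩
  have h_cont : Continuous fun y => u y * (isOne s y - q s y) :=
    hu.mul ((continuous_isOne s).sub (hc s))
  have h_dep : DependsOn (fun y => u y * (isOne s y - q s y)) (Set.Iic s) := fun y y' hy => by
    have hlt : ∀ i ∈ Set.Iio s, y i = y' i := fun i hi => hy i (Set.mem_Iio.1 hi).le
    simp only [hud hlt, hd s hlt, isOne, hy s Set.self_mem_Iic]
  have h_lim : Tendsto (fun n => ∫ y, u y * (isOne s y - q s y) ∂ν n) (hyperfilter ℕ : Filter ℕ)
      (𝓝 (∫ y, u y * (isOne s y - q s y) ∂μ)) :=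
    ProbabilityMeasure.tendsto_iff_forall_integral_tendsto.1 hμ
      (BoundedContinuousFunction.mkOfCompact ⟨_, h_cont⟩)
  have h_zero : ∀ᶠ n : ℕ in hyperfilter ℕ, ∫ y, u y * (isOne s y - q s y) ∂ν n = 0 := by
    filter_upwards [Nat.hyperfilter_le_atTop (eventually_gt_atTop s.natAbs)] with n hn
    rw [hν n _ h_cont, resample_eq_zero h_dep (transfer_mul_sub_eq_zero (hd s) hud) (by omega)
      (by push_cast; omega), Pi.zero_apply]
  exact tendsto_nhds_unique (h_lim.congr' h_zero) tendsto_const_nhds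

theorem exists_hasConditionals (hq : ∀ s y, q s y ∈ Set.Icc (0 : ℝ) 1)
    (hd : ∀ s, DependsOn (q s) (Set.Iio s)) (hc : ∀ s, Continuous (q s)) :
    ∃ μ : ProbabilityMeasure BinSeq, HasConditionals q μ := by
  obtain ⟨μ, hμ⟩ := exists_measure_forall_continuous_integral_eq_zero hq hd hc
  refine ⟨μ, fun s => ?_⟩
  have h_int : Integrable (fun y => isOne s y - q s y) μ :=
    integrable_of_continuous ((continuous_isOne s).sub (hc s)) _
  have h_meas {C : Set BinSeq} (hC : MeasurableSet C) : MeasurableSet (past s ⁻¹' C) :=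
    (continuous_past s).measurable hC
  have h_univ : ∫ y, (isOne s y - q s y) ∂μ = 0 := by
    simpa only [one_mul] using hμ s (fun _ => 1) continuous_const fun _ _ _ => rfl
  refine MeasurableSpace.induction_on_inter generateFrom_measurableCylinders.symm
    isPiSystem_measurableCylinders (by simp) (fun C hC => ?_) (fun C hC h => ?_)
    fun C h_disj hC h => ?_
  · rw [← integral_indicator (h_meas (.of_mem_measurableCylinders hC)),
      ← hμ s (C.indicator 1 ∘ past s)
        ((continuous_indicator_of_mem_measurableCylinders hC).comp (continuous_past s))
        fun y y' hy => congrArg (C.indicator 1) (dependsOn_past s hy)]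
    refine integral_congr_ae (.of_forall fun y => ?_)
    by_cases hy : past s y ∈ C <;> simp [hy]
  · rw [Set.preimage_compl, setIntegral_compl (h_meas hC) h_int, h, h_univ, sub_zero]
  · rw [Set.preimage_iUnion, integral_iUnion (fun i => h_meas (hC i))
      (fun i j hij => (h_disj hij).preimage _) h_int.integrableOn]
    simp only [h, tsum_zero]

end Fiber

section Kernel

variable {S : Type*} [MeasurableSpace S] {p : S → ℤ → BinSeq → ℝ}

lemma isCompatible_compProd (hp : IsSpecification p) {ν : Measure S} [IsFiniteMeasure ν]
    {η : Kernel S BinSeq} [IsMarkovKernel η] (h : ∀ᵐ x ∂ν, HasConditionals (p x) (η x)) :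
    IsCompatible p (ν ⊗ₘ η) := by
  rintro s C ⟨C, hC, rfl⟩
  have hCs : MeasurableSet (Prod.map id (past s) ⁻¹' C : Set (S × BinSeq)) :=
    pastAlgebra_le s _ ⟨C, hC, rfl⟩
  rw [← integral_indicator hCs, Measure.integral_compProd
    ((hp.integrable_innovation s _).indicator hCs)]
  refine integral_eq_zero_of_ae ?_
  filter_upwards [h] with x hx
  rw [Pi.zero_apply, ← hx s _ (measurable_prodMk_left hC), ← integral_indicator
    ((continuous_past s).measurable (measurable_prodMk_left hC))]
  rfl

lemma HasConditionals.tendsto_resample {q : ℤ → BinSeq → ℝ} {μ : Measure BinSeq}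
    [IsProbabilityMeasure μ] (hμ : HasConditionals q μ) (hq : IsSpecification fun _ : Unit => q)
    (hF : Forgets q) {a t : ℤ} {h : BinSeq → ℝ} (hm : Measurable h) (hh : ∀ y, |h y| ≤ 1)
    (hd : DependsOn h (Set.Ico a t)) :
    Tendsto (fun n : ℕ => resample q (t - n) n h 0) atTop (𝓝 (∫ y, h y ∂μ)) := by
  have h_compat : IsCompatible (fun _ : Unit => q) (Measure.dirac () ⊗ₘ Kernel.const Unit μ) :=
    isCompatible_compProd hq (.of_forall fun _ => hμ)
  have h_int : Integrable (fun z : Unit × BinSeq => h z.2)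
      (Measure.dirac () ⊗ₘ Kernel.const Unit μ) :=
    .of_bound (hm.comp measurable_snd).aestronglyMeasurable 1 (.of_forall fun z => hh z.2)
  have h_fst : (Measure.dirac () ⊗ₘ Kernel.const Unit μ).map Prod.fst = Measure.dirac () :=
    Measure.fst_compProd _ _
  have h_lim := h_compat.tendsto_integral_resample hq (.of_forall fun _ => hF) hm hh hd
  rw [Measure.integral_compProd h_int] at h_lim
  simpa only [h_fst, integral_dirac, Kernel.const_apply] using h_lim

lemma measurable_of_hasConditionals (hp : IsSpecification p) {G : Set S} (hG : MeasurableSet G)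
    (hF : ∀ x ∈ G, Forgets (p x)) {μ : S → ProbabilityMeasure BinSeq}
    (hμ : ∀ x ∈ G, HasConditionals (p x) (μ x)) {μ₀ : Measure BinSeq} (hμ₀ : ∀ x ∉ G, μ x = μ₀) :
    Measurable fun x => (μ x : Measure BinSeq) := by
  classical
  refine .measure_of_isPiSystem_of_isProbabilityMeasure generateFrom_measurableCylinders.symm
    isPiSystem_measurableCylinders fun C hC => ?_
  have hCm : MeasurableSet C := .of_mem_measurableCylinders hC
  obtain ⟨a, t, hd⟩ := exists_dependsOn_Ico_of_mem_measurableCylinders hC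
  have hm : Measurable (C.indicator (1 : BinSeq → ℝ)) := measurable_one.indicator hCm
  have hb (y : BinSeq) : |C.indicator (1 : BinSeq → ℝ) y| ≤ 1 := by
    by_cases hy : y ∈ C <;> simp [hy]
  have h_real : Measurable fun x => (μ x : Measure BinSeq).real C := by
    refine measurable_of_tendsto_metrizable (f := fun (n : ℕ) x =>
      if x ∈ G then resample (p x) (t - n) n (C.indicator 1) 0 else μ₀.real C) (fun n => ?_)
      (tendsto_pi_nhds.2 fun x => ?_)
    · exact .ite hG ((hp.measurable_resample hm _ n).comp
        (measurable_id.prodMk measurable_const)) measurable_const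
    · by_cases hx : x ∈ G
      · have hpx : IsSpecification fun _ : Unit => p x := hp.comp (φ := fun _ => x) measurable_const
        simpa only [hx, if_true, integral_indicator_one hCm] using
          (hμ x hx).tendsto_resample hpx (hF x hx) hm hb hd
      · simp only [hx, if_false, hμ₀ x hx, tendsto_const_nhds]
  simpa using h_real.ennreal_ofReal

theorem exists_kernel_isCompatible (hp : IsSpecification p) (ν : Measure S) [IsFiniteMeasure ν]
    (hc : ∀ᵐ x ∂ν, ∀ s, Continuous (p x s)) (hF : ∀ᵐ x ∂ν, Forgets (p x)) :
    ∃ η : Kernel S BinSeq, IsMarkovKernel η ∧ IsCompatible p (ν ⊗ₘ η) := by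
  classical
  obtain ⟨N, hN_sub, hN_meas, hN_null⟩ := exists_measurable_superset_of_null (ae_iff.1 (hc.and hF))
  have hgood (x) (hx : x ∈ Nᶜ) : (∀ s, Continuous (p x s)) ∧ Forgets (p x) :=
    not_not.1 fun h => hx (hN_sub h)
  have h_exists (x : S) : ∃ μ : ProbabilityMeasure BinSeq,
      (x ∈ Nᶜ → HasConditionals (p x) μ) ∧ (x ∉ Nᶜ → (μ : Measure BinSeq) = Measure.dirac 0) := by
    by_cases hx : x ∈ Nᶜ
    · obtain ⟨μ, hμ⟩ := exists_hasConditionals (hp.mem_Icc x) (hp.dependsOn x) (hgood x hx).1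
      exact ⟨μ, fun _ => hμ, fun h => absurd hx h⟩
    · exact ⟨⟨Measure.dirac 0, inferInstance⟩, fun h => absurd h hx, fun _ => rfl⟩
  choose μ hμ hμ₀ using h_exists
  let η : Kernel S BinSeq := ⟨fun x => μ x,
    measurable_of_hasConditionals hp hN_meas.compl (fun x hx => (hgood x hx).2) hμ hμ₀⟩
  have hη : IsMarkovKernel η := ⟨fun x => (μ x).2⟩
  refine ⟨η, hη, isCompatible_compProd hp ?_⟩
  filter_upwards [compl_mem_ae_iff.2 hN_null] with x hx
  exact hμ x hx

end Kernel

/-! ### Stationarity and ergodicity of compatible laws -/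

lemma measurable_shift {S : Type*} [MeasurableSpace S] : Measurable (shift : (ℤ → S) → ℤ → S) :=
  measurable_pi_lambda _ fun t => measurable_pi_apply (t + 1)

lemma abs_setIntegral_sub_setIntegral_le {Ω : Type*} [MeasurableSpace Ω] {μ : Measure Ω}
    [IsFiniteMeasure μ] {A B : Set Ω} (hA : MeasurableSet A) (hB : MeasurableSet B) {u : Ω → ℝ}
    (hu : Integrable u μ) {c : ℝ} (hc : ∀ ω, |u ω| ≤ c) :
    |∫ ω in A, u ω ∂μ - ∫ ω in B, u ω ∂μ| ≤ c * μ.real (symmDiff A B) := by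
  have h_le (D : Set Ω) : |∫ ω in D, u ω ∂μ| ≤ c * μ.real D := by
    rw [← Real.norm_eq_abs]
    exact norm_setIntegral_le_of_norm_le_const (measure_lt_top _ _) fun ω _ => hc ω
  have hA_split := integral_inter_add_sdiff hB (hu.integrableOn (s := A))
  have hB_split := integral_inter_add_sdiff hA (hu.integrableOn (s := B))
  rw [Set.inter_comm] at hB_split
  rw [← hA_split, ← hB_split, add_sub_add_left_eq_sub, measureReal_symmDiff_eq hA hB, mul_add]
  exact (abs_sub _ _).trans (add_le_add (h_le _) (h_le _))

section PastEvents

variable {S : Type*} [MeasurableSpace S]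

lemma isSetAlgebra_pastAlgebra :
    IsSetAlgebra {C : Set (S × BinSeq) | ∃ m, MeasurableSet[pastAlgebra S m] C} where
  empty_mem := ⟨0, @MeasurableSet.empty _ (pastAlgebra S 0)⟩
  compl_mem := fun _ ⟨m, hm⟩ => ⟨m, hm.compl⟩
  union_mem := fun _ _ ⟨m, hm⟩ ⟨n, hn⟩ => ⟨max m n,
    .union (pastAlgebra_mono (le_max_left m n) _ hm) (pastAlgebra_mono (le_max_right m n) _ hn)⟩

lemma generateFrom_pastAlgebra : (Prod.instMeasurableSpace : MeasurableSpace (S × BinSeq)) =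
    MeasurableSpace.generateFrom {C | ∃ m, MeasurableSet[pastAlgebra S m] C} := by
  refine le_antisymm (sup_le ?_ ?_)
    (MeasurableSpace.generateFrom_le fun C ⟨m, hm⟩ => pastAlgebra_le m C hm)
  · rintro _ ⟨B, hB, rfl⟩
    exact MeasurableSpace.measurableSet_generateFrom ⟨0, measurable_fst_pastAlgebra 0 hB⟩
  · simp only [MeasurableSpace.pi, MeasurableSpace.comap_iSup, MeasurableSpace.comap_comp]
    refine iSup_le fun i => ?_
    rintro _ ⟨B, hB, rfl⟩
    exact MeasurableSpace.measurableSet_generateFrom ⟨i + 1, measurable_pastAlgebra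
      ((measurable_pi_apply i).comp measurable_snd) (fun _ _ _ hy => hy i (lt_add_one i)) hB⟩

lemma exists_pastAlgebra_measureReal_symmDiff_lt (ρ : Measure (S × BinSeq)) [IsFiniteMeasure ρ]
    {A : Set (S × BinSeq)} (hA : MeasurableSet A) {ε : ℝ} (hε : 0 < ε) :
    ∃ m B, MeasurableSet[pastAlgebra S m] B ∧ ρ.real (symmDiff A B) < ε := by
  obtain ⟨B, ⟨m, hB⟩, hAB⟩ := (Measure.MeasureDense.of_generateFrom_isSetAlgebra_finite ρ
    isSetAlgebra_pastAlgebra generateFrom_pastAlgebra).approx A hA (measure_ne_top _ _) ε hε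
  exact ⟨m, B, hB, ENNReal.toReal_lt_of_lt_ofReal hAB⟩

lemma measurable_prodMap_shift {θ : S → S} (hθ : Measurable θ) (s : ℤ) :
    Measurable[pastAlgebra S (s + 1), pastAlgebra S s] (Prod.map θ shift) := by
  have h_semiconj : Prod.map id (past s) ∘ Prod.map θ shift =
      Prod.map θ shift ∘ Prod.map id (past (s + 1)) := by
    funext z
    refine Prod.ext rfl (funext fun i => ?_)
    simp only [Function.comp_apply, Prod.map_snd, past, shift, add_lt_add_iff_right]
  rw [measurable_comap_iff, h_semiconj]
  exact (hθ.prodMap measurable_shift).comp (comap_measurable _)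

end PastEvents

/-- The specification commutes with the transformation `θ` of the environment and the shift of the
binary sequence. -/
def IsEquivariant {S : Type*} (p : S → ℤ → BinSeq → ℝ) (θ : S → S) : Prop :=
  ∀ x s y, p (θ x) s (shift y) = p x (s + 1) y

section Equivariant

variable {S : Type*} [MeasurableSpace S] {p : S → ℤ → BinSeq → ℝ} {θ : S → S}
  {ρ : Measure (S × BinSeq)}

lemma IsEquivariant.setIntegral_innovation_map (hθ : IsEquivariant p θ) (hp : IsSpecification p)
    (hθm : Measurable θ) {C : Set (S × BinSeq)} (hC : MeasurableSet C) (s : ℤ) :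
    ∫ z in C, innovation p s z ∂ρ.map (Prod.map θ shift) =
      ∫ z in Prod.map θ shift ⁻¹' C, innovation p (s + 1) z ∂ρ := by
  rw [setIntegral_map hC (hp.measurable_innovation s).aestronglyMeasurable
    (hθm.prodMap measurable_shift).aemeasurable]
  exact integral_congr_ae (.of_forall fun z => congrArg _ (hθ z.1 s z.2))

lemma IsEquivariant.exists_setIntegral_innovation_eq (hθ : IsEquivariant p θ)
    (hp : IsSpecification p) (hθm : Measurable θ) (hρ : MeasurePreserving (Prod.map θ shift) ρ ρ)
    {s : ℤ} {C : Set (S × BinSeq)} (hC : MeasurableSet[pastAlgebra S s] C) (n : ℕ) :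
    ∃ D, MeasurableSet[pastAlgebra S (s + n)] D ∧
      ∫ z in C, innovation p s z ∂ρ = ∫ z in D, innovation p (s + n) z ∂ρ := by
  induction n with
  | zero =>
    rw [Nat.cast_zero, add_zero]
    exact ⟨C, hC, rfl⟩
  | succ n ih =>
    obtain ⟨D, hD, hCD⟩ := ih
    rw [Nat.cast_succ, ← add_assoc]
    refine ⟨_, measurable_prodMap_shift hθm _ hD, ?_⟩
    rw [hCD, ← hθ.setIntegral_innovation_map hp hθm (pastAlgebra_le _ _ hD), hρ.map_eq]

namespace IsCompatible

lemma smul (hρ : IsCompatible p ρ) (c : ENNReal) : IsCompatible p (c • ρ) := fun s C hC => by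
  rw [Measure.restrict_smul, integral_smul_measure, hρ s C hC, smul_zero]

lemma map_prodMap_shift (hρ : IsCompatible p ρ) (hp : IsSpecification p) (hθ : IsEquivariant p θ)
    (hθm : Measurable θ) : IsCompatible p (ρ.map (Prod.map θ shift)) := by
  intro s C hC
  rw [hθ.setIntegral_innovation_map hp hθm (pastAlgebra_le s _ hC)]
  exact hρ _ _ (measurable_prodMap_shift hθm s hC)

variable [IsFiniteMeasure ρ]

lemma restrict_of_invariant (hρ : IsCompatible p ρ) (hp : IsSpecification p)
    (hθ : IsEquivariant p θ) (hθm : Measurable θ) {A : Set (S × BinSeq)} (hA : MeasurableSet A)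
    (hρA : MeasurePreserving (Prod.map θ shift) (ρ.restrict A) (ρ.restrict A)) :
    IsCompatible p (ρ.restrict A) := by
  intro s C hC
  refine eq_of_abs_sub_le_all fun ε hε => ?_
  obtain ⟨m, B, hB, hAB⟩ := exists_pastAlgebra_measureReal_symmDiff_lt ρ hA hε
  -- Shifting the event `C` far to the right puts the approximation `B` of `A` in its past.
  obtain ⟨D, hD, hCD⟩ := hθ.exists_setIntegral_innovation_eq hp hθm hρA hC (m - s).toNat
  have hDm : MeasurableSet D := pastAlgebra_le _ _ hD
  have h_zero := hρ _ _ (hD.inter (pastAlgebra_mono (by omega) _ hB))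
  rw [hCD, Measure.restrict_restrict hDm, ← h_zero]
  calc _ ≤ 1 * ρ.real (symmDiff (D ∩ A) (D ∩ B)) :=
        abs_setIntegral_sub_setIntegral_le (hDm.inter hA) (hDm.inter (pastAlgebra_le m _ hB))
          (hp.integrable_innovation _ ρ) (hp.abs_innovation_le_one _)
    _ ≤ ρ.real (symmDiff A B) := by
        rw [one_mul, ← Set.inter_symmDiff_distrib_left]
        exact measureReal_mono Set.inter_subset_right
    _ ≤ ε := hAB.le

theorem measurePreserving (hρ : IsCompatible p ρ) (hp : IsSpecification p)
    (hθ : IsEquivariant p θ) (hF : ∀ᵐ x ∂ρ.map Prod.fst, Forgets (p x))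
    (hθρ : MeasurePreserving θ (ρ.map Prod.fst) (ρ.map Prod.fst)) :
    MeasurePreserving (Prod.map θ shift) ρ ρ := by
  have hσ : Measurable (Prod.map θ shift : S × BinSeq → S × BinSeq) :=
    hθρ.measurable.prodMap measurable_shift
  refine ⟨hσ, hρ.eq_of_map_fst_eq (hρ.map_prodMap_shift hp hθ hθρ.measurable) hp hF ?_⟩
  calc (ρ.map (Prod.map θ shift)).map Prod.fst = (ρ.map Prod.fst).map θ := by
        rw [Measure.map_map measurable_fst hσ, Measure.map_map hθρ.measurable measurable_fst]
        rfl
    _ = ρ.map Prod.fst := hθρ.map_eq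

end IsCompatible

theorem IsCompatible.ergodic [IsProbabilityMeasure ρ] (hρ : IsCompatible p ρ)
    (hp : IsSpecification p) (hθ : IsEquivariant p θ)
    (hF : ∀ᵐ x ∂ρ.map Prod.fst, Forgets (p x)) (hθρ : Ergodic θ (ρ.map Prod.fst)) :
    Ergodic (Prod.map θ shift) ρ := by
  have hσ := hρ.measurePreserving hp hθ hF hθρ.toMeasurePreserving
  refine ⟨hσ, ⟨fun A hA h_inv => ?_⟩⟩
  have hσA : MeasurePreserving (Prod.map θ shift) (ρ.restrict A) (ρ.restrict A) := by
    simpa only [h_inv] using hσ.restrict_preimage hA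
  have h_fst : MeasurePreserving θ ((ρ.restrict A).map Prod.fst) ((ρ.restrict A).map Prod.fst) :=
    MeasurePreserving.of_semiconj (measurable_fst.measurePreserving _) hσA (fun _ => rfl)
      hθρ.measurable
  obtain ⟨c, hc⟩ := hθρ.eq_smul_of_absolutelyContinuous h_fst
    (Measure.restrict_le_self.absolutelyContinuous.map measurable_fst)
  obtain rfl : ρ A = c := by
    simpa [Measure.map_apply measurable_fst] using congrArg (· Set.univ) hc
  have : IsFiniteMeasure (ρ A • ρ) := ρ.smul_finite (measure_ne_top ρ A)
  have h_restrict : ρ.restrict A = ρ A • ρ :=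
    (hρ.smul _).eq_of_map_fst_eq (hρ.restrict_of_invariant hp hθ hθρ.measurable hA hσA) hp
      (by rw [Measure.map_smul]; exact Measure.ae_smul_measure hF _)
      (by rw [hc, Measure.map_smul])
  have h_mul : ρ A * ρ Aᶜ = 0 := by
    simpa [hA] using (congrArg (· Aᶜ) h_restrict).symm
  rw [eventuallyConst_set']
  exact (mul_eq_zero.1 h_mul).imp ae_eq_empty.2 fun h => eventuallyEq_univ.2 (mem_ae_iff.2 h)

end Equivariant

/-! ### The latent process -/

/-- The state at time `t` of the recursion `l_t = g l_{t-1} + v_t` started `n` steps earlier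
at `0`. -/
noncomputable def latentIter (g : ℝ → ℝ) (v : ℤ → ℝ) : ℕ → ℤ → ℝ
  | 0, _ => 0
  | n + 1, t => g (latentIter g v n (t - 1)) + v t

/-- The state at time `t` of the recursion `l_t = g l_{t-1} + v_t` started in the infinitely remote
past; a junk value where the iterates diverge. -/
noncomputable def latent (g : ℝ → ℝ) (v : ℤ → ℝ) (t : ℤ) : ℝ :=
  limUnder atTop fun n => latentIter g v n t

/-- The sum of the past of `b` with geometric weights; zero where it diverges. -/
noncomputable def discounted (κ : NNReal) (b : ℤ → ℝ) (t : ℤ) : ℝ :=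
  ∑' i : ℕ, (κ : ℝ) ^ i * b (t - i)

/-- The sums of the past of `b` with geometric weights converge. -/
def IsTame (κ : NNReal) (b : ℤ → ℝ) : Prop :=
  ∀ t : ℤ, Summable fun i : ℕ => (κ : ℝ) ^ i * b (t - i)

lemma latentIter_shift (g : ℝ → ℝ) (v : ℤ → ℝ) (n : ℕ) (t : ℤ) :
    latentIter g (shift v) n t = latentIter g v n (t + 1) := by
  induction n generalizing t with
  | zero => rfl
  | succ n ih => simp only [latentIter, ih, shift, sub_add_cancel, add_sub_cancel_right]

lemma latent_shift (g : ℝ → ℝ) (v : ℤ → ℝ) (t : ℤ) :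
    latent g (shift v) t = latent g v (t + 1) := by
  simp only [latent, latentIter_shift]

lemma latentIter_congr (g : ℝ → ℝ) {v v' : ℤ → ℝ} {t : ℤ} (h : ∀ i ≤ t, v i = v' i) (n : ℕ) :
    latentIter g v n t = latentIter g v' n t := by
  induction n generalizing t with
  | zero => rfl
  | succ n ih => rw [latentIter, latentIter, h t le_rfl, ih fun i hi => h i (by omega)]

lemma latent_congr (g : ℝ → ℝ) {v v' : ℤ → ℝ} {t : ℤ} (h : ∀ i ≤ t, v i = v' i) :
    latent g v t = latent g v' t := by
  simp only [latent, latentIter_congr g h]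

lemma measurable_latent {Ω : Type*} [MeasurableSpace Ω] {g : ℝ → ℝ} (hg : Measurable g)
    {v : Ω → ℤ → ℝ} (hv : Measurable v) (t : ℤ) : Measurable fun ω => latent g (v ω) t := by
  have h_iter (n : ℕ) (t : ℤ) : Measurable fun ω => latentIter g (v ω) n t := by
    induction n generalizing t with
    | zero => exact measurable_const
    | succ n ih => exact (hg.comp (ih (t - 1))).add (measurable_pi_iff.1 hv t)
  exact (StronglyMeasurable.limUnder fun n => (h_iter n t).stronglyMeasurable).measurable

lemma measurable_discounted (κ : NNReal) (t : ℤ) : Measurable fun b => discounted κ b t :=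
  Measurable.tsum fun _ => (measurable_pi_apply _).const_mul _

section Contraction

variable {g : ℝ → ℝ} {κ : NNReal} {v b : ℤ → ℝ}

lemma abs_sub_le_pow_mul (hg : LipschitzWith κ g) {l l' : ℤ → ℝ} {s : ℤ} (n : ℕ)
    (h : ∀ t, s < t → t ≤ s + n → l t - g (l (t - 1)) = l' t - g (l' (t - 1))) :
    |l (s + n) - l' (s + n)| ≤ κ ^ n * |l s - l' s| := by
  induction n with
  | zero => simp
  | succ n ih =>
    have h_last := h (s + (n + 1 : ℕ)) (by omega) le_rfl
    rw [show s + ((n + 1 : ℕ) : ℤ) - 1 = s + n by push_cast; ring] at h_last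
    calc |l (s + (n + 1 : ℕ)) - l' (s + (n + 1 : ℕ))| = |g (l (s + n)) - g (l' (s + n))| := by
          rw [sub_eq_sub_iff_sub_eq_sub.1 h_last]
      _ ≤ κ * |l (s + n) - l' (s + n)| := hg.dist_le_mul _ _
      _ ≤ κ * (κ ^ n * |l s - l' s|) := by
          gcongr
          exact ih fun t hst htn => h t hst (by push_cast; omega)
      _ = κ ^ (n + 1) * |l s - l' s| := by ring

lemma abs_latentIter_succ_sub_le (hg : LipschitzWith κ g) (hb : ∀ t, |g 0 + v t| ≤ b t) (n : ℕ)
    (t : ℤ) : |latentIter g v (n + 1) t - latentIter g v n t| ≤ κ ^ n * b (t - n) := by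
  induction n generalizing t with
  | zero => simpa [latentIter] using hb t
  | succ n ih =>
    calc |latentIter g v (n + 1 + 1) t - latentIter g v (n + 1) t|
        = |g (latentIter g v (n + 1) (t - 1)) - g (latentIter g v n (t - 1))| :=
          congrArg abs (add_sub_add_right_eq_sub _ _ _)
      _ ≤ κ * |latentIter g v (n + 1) (t - 1) - latentIter g v n (t - 1)| := hg.dist_le_mul _ _
      _ ≤ κ * (κ ^ n * b (t - 1 - n)) := by
          gcongr
          exact ih (t - 1)
      _ = κ ^ (n + 1) * b (t - (n + 1 : ℕ)) := by
          rw [Nat.cast_succ, add_comm (n : ℤ), sub_add_eq_sub_sub]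
          ring

namespace IsTame

lemma tendsto_latentIter (hT : IsTame κ b) (hg : LipschitzWith κ g)
    (hb : ∀ t, |g 0 + v t| ≤ b t) (t : ℤ) :
    Tendsto (fun n => latentIter g v n t) atTop (𝓝 (latent g v t)) := by
  refine CauchySeq.tendsto_limUnder (cauchySeq_of_dist_le_of_summable _ (fun n => ?_) (hT t))
  rw [dist_comm]
  exact abs_latentIter_succ_sub_le hg hb n t

lemma dist_latentIter_latent_le (hT : IsTame κ b) (hg : LipschitzWith κ g)
    (hb : ∀ t, |g 0 + v t| ≤ b t) (n : ℕ) (t : ℤ) :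
    dist (latentIter g v n t) (latent g v t)
      ≤ ∑' m : ℕ, (κ : ℝ) ^ (n + m) * b (t - (n + m : ℕ)) := by
  refine dist_le_tsum_of_dist_le_of_tendsto (fun n : ℕ => (κ : ℝ) ^ n * b (t - n)) (fun n => ?_)
    (hT t) (hT.tendsto_latentIter hg hb t) n
  rw [dist_comm]
  exact abs_latentIter_succ_sub_le hg hb n t

lemma abs_latent_le (hT : IsTame κ b) (hg : LipschitzWith κ g) (hb : ∀ t, |g 0 + v t| ≤ b t)
    (t : ℤ) : |latent g v t| ≤ discounted κ b t := by
  simpa [latentIter, discounted] using hT.dist_latentIter_latent_le hg hb 0 t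

lemma latent_eq (hT : IsTame κ b) (hg : LipschitzWith κ g) (hb : ∀ t, |g 0 + v t| ≤ b t) (t : ℤ) :
    latent g v t = g (latent g v (t - 1)) + v t :=
  tendsto_nhds_unique ((tendsto_add_atTop_iff_nat 1).2 (hT.tendsto_latentIter hg hb t))
    (((hg.continuous.tendsto _).comp (hT.tendsto_latentIter hg hb (t - 1))).add_const _)

lemma continuous_latent {A : Type*} [TopologicalSpace A] (hT : IsTame κ b)
    (hg : LipschitzWith κ g) {v : A → ℤ → ℝ} (hv : Continuous v)
    (hb : ∀ a t, |g 0 + v a t| ≤ b t) (t : ℤ) : Continuous fun a => latent g (v a) t := by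
  have h_iter (n : ℕ) (t : ℤ) : Continuous fun a => latentIter g (v a) n t := by
    induction n generalizing t with
    | zero => exact continuous_const
    | succ n ih => exact (hg.continuous.comp (ih (t - 1))).add (continuous_pi_iff.1 hv t)
  have h_unif : TendstoUniformly (fun n a => latentIter g (v a) n t)
      (fun a => latent g (v a) t) atTop := by
    refine Metric.tendstoUniformly_iff.2 fun ε hε => ?_
    have h_tail := tendsto_sum_nat_add fun i : ℕ => (κ : ℝ) ^ i * b (t - i)
    filter_upwards [h_tail.eventually_lt_const hε] with n hn a
    rw [dist_comm]
    refine (hT.dist_latentIter_latent_le hg (hb a) n t).trans_lt ?_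
    simpa only [add_comm n] using hn
  exact h_unif.continuous (Frequently.of_forall fun n => h_iter n t)

lemma const (hκ : κ < 1) (c : ℝ) : IsTame κ fun _ => c := fun _ =>
  (summable_geometric_of_lt_one κ.coe_nonneg hκ).mul_right c

lemma add {b' : ℤ → ℝ} (hT : IsTame κ b) (hT' : IsTame κ b') : IsTame κ fun t => b t + b' t :=
  fun t => by simpa only [mul_add] using (hT t).add (hT' t)

lemma const_mul (hT : IsTame κ b) (c : ℝ) : IsTame κ fun t => c * b t := fun t => by
  simpa only [mul_left_comm] using (hT t).mul_left c

end IsTame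

end Contraction

/-- In the remote past there are times at which `m` is below a fixed level and, for each window
length, such times after which `m` stays bounded by a constant on the whole window. -/
def IsRecurrentlyBounded (m : ℤ → ℝ) : Prop :=
  ∃ k, ∀ N : ℕ, ∃ k', ∀ s₀, ∃ s ≤ s₀, m s ≤ k ∧ ∀ j < N, m (s + j) ≤ k'

section LatentForgets

variable {F g : ℝ → ℝ} {K κ : NNReal} {v : BinSeq → ℤ → ℝ} {b : ℤ → ℝ}

lemma IsTame.hasGeometricMemory (hT : IsTame κ b) (hF : LipschitzWith K F) (hg : LipschitzWith κ g)
    (hκ : κ < 1) (hb : ∀ y t, |g 0 + v y t| ≤ b t)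
    (hv : ∀ t, DependsOn (fun y => v y t) {t - 1}) {s : ℤ} {k : ℝ} (hk : discounted κ b s ≤ k) :
    HasGeometricMemory (fun t y => F (latent g (v y) t)) s (2 * K * k / (1 - κ)) κ := by
  intro j y y' hy
  have h_start : |latent g (v y) s - latent g (v y') s| ≤ 2 * k :=
    (abs_sub _ _).trans (by linarith [hT.abs_latent_le hg (hb y) s, hT.abs_latent_le hg (hb y') s])
  have h_drive (t : ℤ) (hst : s < t) (htj : t ≤ s + j) : v y t = v y' t := by
    refine hv t fun i hi => ?_
    rw [Set.mem_singleton_iff.1 hi]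
    exact hy _ ⟨by omega, by omega⟩
  have h_end := abs_sub_le_pow_mul hg (l := latent g (v y)) (l' := latent g (v y')) j
    fun t hst htj => by
      rw [hT.latent_eq hg (hb y) t, hT.latent_eq hg (hb y') t, h_drive t hst htj,
        add_sub_cancel_left, add_sub_cancel_left]
  have hκ' : 1 - (κ : ℝ) ≠ 0 := (sub_pos.2 (NNReal.coe_lt_one.2 hκ)).ne'
  calc |F (latent g (v y) (s + j)) - F (latent g (v y') (s + j))|
      ≤ K * |latent g (v y) (s + j) - latent g (v y') (s + j)| := hF.dist_le_mul _ _
    _ ≤ K * (κ ^ j * (2 * k)) := by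
        gcongr
        exact h_end.trans (by gcongr)
    _ = 2 * K * k / (1 - κ) * (1 - κ) * κ ^ j := by field_simp

theorem IsTame.forgets (hT : IsTame κ b) (hF : LipschitzWith K F)
    (hF_mem : ∀ s, F s ∈ Set.Ioc (0 : ℝ) 1) (hg : LipschitzWith κ g) (hκ : κ < 1)
    (hb : ∀ y t, |g 0 + v y t| ≤ b t) (hv : ∀ t, DependsOn (fun y => v y t) {t - 1})
    (h_rec : IsRecurrentlyBounded (discounted κ b)) : Forgets fun t y => F (latent g (v y) t) := by
  obtain ⟨k, hk⟩ := h_rec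
  have hκ' : 0 < 1 - (κ : ℝ) := sub_pos.2 (NNReal.coe_lt_one.2 hκ)
  have hk₀ : 0 ≤ k := by
    obtain ⟨_, h⟩ := hk 0
    obtain ⟨s, -, hs, -⟩ := h 0
    exact ((abs_nonneg _).trans (hT.abs_latent_le hg (hb 0) s)).trans hs
  obtain ⟨N, hN⟩ : ∃ N : ℕ, 2 * K * k / (1 - κ) * (κ : ℝ) ^ N ≤ 1 / 2 := by
    have h_lim := (tendsto_pow_atTop_nhds_zero_of_lt_one κ.coe_nonneg hκ).const_mul
      (2 * K * k / (1 - (κ : ℝ)))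
    rw [mul_zero] at h_lim
    exact (h_lim.eventually_le_const one_half_pos).exists
  obtain ⟨k', hk'⟩ := hk N
  obtain ⟨c, hc₀, hc⟩ := (isCompact_Icc (a := -k') (b := k')).exists_forall_le'
    hF.continuous.continuousOn fun s _ => (hF_mem s).1
  refine forgets_of_recurrent (fun s y => Set.Ioc_subset_Icc_self (hF_mem _)) (by positivity)
    κ.coe_nonneg hκ hN hc₀ fun s₀ => ?_
  obtain ⟨s, hs, hsk, hsj⟩ := hk' s₀
  exact ⟨s, hs, hT.hasGeometricMemory hF hg hκ hb hv hsk, fun j hj y =>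
    hc _ (abs_le.1 ((hT.abs_latent_le hg (hb y) _).trans (hsj j hj)))⟩

end LatentForgets

/-! ### Stationary environments -/

/-- Translation of a two-sided sequence by an arbitrary integer. -/
def translate {E : Type*} (s : ℤ) (x : ℤ → E) : ℤ → E := fun t => x (t + s)

lemma translate_zero {E : Type*} (x : ℤ → E) : translate 0 x = x :=
  funext fun t => congrArg x (add_zero t)

lemma translate_translate {E : Type*} (s t : ℤ) (x : ℤ → E) :
    translate s (translate t x) = translate (s + t) x :=
  funext fun u => congrArg x (add_assoc u s t)

lemma discounted_translate (κ : NNReal) (b : ℤ → ℝ) (s t : ℤ) :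
    discounted κ (translate s b) t = discounted κ b (t + s) := by
  simp only [discounted, translate, sub_add_eq_add_sub]

section Environment

variable {E : Type*} [MeasurableSpace E] {ν : Measure (ℤ → E)}

lemma measurable_translate (s : ℤ) : Measurable (translate s : (ℤ → E) → ℤ → E) :=
  measurable_pi_lambda _ fun t => measurable_pi_apply (t + s)

lemma measurePreserving_translate (hν : MeasurePreserving shift ν ν) (s : ℤ) :
    MeasurePreserving (translate s) ν ν := by
  have h_shift (s : ℤ) : translate s ∘ shift = (translate (s + 1) : (ℤ → E) → ℤ → E) :=
    funext (translate_translate s 1)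
  have h_step (s : ℤ) : ν.map (translate (s + 1)) = ν.map (translate s) := by
    rw [← h_shift, ← Measure.map_map (measurable_translate s) hν.measurable, hν.map_eq]
  refine ⟨measurable_translate s, ?_⟩
  induction s with
  | zero =>
    rw [show translate 0 = (id : (ℤ → E) → ℤ → E) from funext translate_zero, Measure.map_id]
  | succ n ih => rw [h_step, ih]
  | pred n ih => rw [← h_step, sub_add_cancel, ih]

lemma ae_mem_imp_exists_translate_mem [IsFiniteMeasure ν] (hν : MeasurePreserving shift ν ν)
    {A : Set (ℤ → E)} (hA : MeasurableSet A) :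
    ∀ᵐ x ∂ν, x ∈ A → ∀ s₀ : ℤ, ∃ s ≤ s₀, translate s x ∈ A := by
  have h_iter (n : ℕ) (x : ℤ → E) : (translate (-1))^[n] x = translate (-n) x := by
    induction n with
    | zero => exact (translate_zero x).symm
    | succ n ih =>
      rw [Function.iterate_succ_apply', ih, translate_translate, Nat.cast_succ, neg_add_rev]
  filter_upwards [(measurePreserving_translate hν (-1)).conservative.ae_mem_imp_frequently_image_mem
    hA.nullMeasurableSet] with x hx hxA s₀
  obtain ⟨n, hn, hnA⟩ := (hx hxA).forall_exists_of_atTop s₀.natAbs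
  exact ⟨-n, by omega, h_iter n x ▸ hnA⟩

lemma ae_isRecurrentlyBounded [IsFiniteMeasure ν] (hν : MeasurePreserving shift ν ν)
    {m : (ℤ → E) → ℝ} (hm : Measurable m) :
    ∀ᵐ x ∂ν, IsRecurrentlyBounded fun t => m (translate t x) := by
  let A (k k' N : ℕ) : Set (ℤ → E) :=
    {x | m x ≤ k} ∩ ⋂ j : ℕ, ⋂ _ : j < N, {x | m (translate j x) ≤ k'}
  have hA (k k' N : ℕ) : MeasurableSet (A k k' N) :=
    (measurableSet_le hm measurable_const).inter <| .iInter fun j => .iInter fun _ =>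
      measurableSet_le (hm.comp (measurable_translate j)) measurable_const
  have h_return : ∀ᵐ x ∂ν, ∀ k k' N : ℕ, x ∈ A k k' N →
      ∀ s₀ : ℤ, ∃ s ≤ s₀, translate s x ∈ A k k' N := by
    simp only [ae_all_iff]
    exact fun k k' N => ae_mem_imp_exists_translate_mem hν (hA k k' N)
  filter_upwards [h_return] with x hx
  obtain ⟨k, hk⟩ := exists_nat_ge (m x)
  refine ⟨k, fun N => ?_⟩
  obtain ⟨B, hB⟩ := Set.Finite.bddAbove
    (Set.Finite.image (fun j : ℕ => m (translate j x)) (Set.finite_lt_nat N))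
  obtain ⟨k', hk'⟩ := exists_nat_ge B
  refine ⟨k', fun s₀ => ?_⟩
  obtain ⟨s, hs, hsk, hsj⟩ := hx k k' N
    ⟨hk, Set.mem_iInter₂.2 fun j hj => (hB (Set.mem_image_of_mem _ hj)).trans hk'⟩ s₀
  refine ⟨s, hs, hsk, fun j hj => ?_⟩
  simpa only [add_comm s, ← translate_translate, Set.mem_ofPred_eq]
    using Set.mem_iInter₂.1 hsj j hj

end Environment

section LogMoment

variable {E : Type*} [NormedAddCommGroup E] [MeasurableSpace E] [BorelSpace E]
  {ν : Measure (ℤ → E)} [IsProbabilityMeasure ν]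

lemma ae_eventually_norm_le_exp (hν : MeasurePreserving shift ν ν)
    (hlog : Integrable (fun x : ℤ → E => Real.posLog ‖x 0‖) ν) {ε : ℝ} (hε : 0 < ε) (t : ℤ) :
    ∀ᵐ x ∂ν, ∀ᶠ n : ℕ in atTop, ‖x (t - n)‖ ≤ Real.exp (ε * n) := by
  have h_log : Measurable fun x : ℤ → E => ε⁻¹ * Real.posLog ‖x 0‖ :=
    ((Real.continuous_posLog.comp continuous_norm).measurable.comp
      (measurable_pi_apply 0)).const_mul _
  let _ : MeasureSpace (ℤ → E) := ⟨ν⟩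
  have h_tails : ∑' n : ℕ, ν {x | ε⁻¹ * Real.posLog ‖x (t - n)‖ ∈ Set.Ioi (n : ℝ)} ≠ ⊤ := by
    have h_sum := tsum_prob_mem_Ioi_lt_top (hlog.const_mul ε⁻¹)
      fun x => mul_nonneg (inv_nonneg.2 hε.le) Real.posLog_nonneg
    have h_shifted (n : ℕ) := (measurePreserving_translate hν (t - n)).measure_preimage
      (h_log (measurableSet_Ioi (a := (n : ℝ)))).nullMeasurableSet
    simp only [translate, zero_add, Set.preimage_preimage] at h_shifted
    exact (tsum_congr h_shifted).trans_ne h_sum.ne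
  filter_upwards [ae_eventually_notMem h_tails] with x hx
  filter_upwards [hx] with n hn
  rcases (norm_nonneg (x (t - n))).eq_or_lt with h₀ | h₀
  · rw [← h₀]
    positivity
  · rw [← Real.log_le_iff_le_exp h₀, ← inv_mul_le_iff₀ hε]
    exact (mul_le_mul_of_nonneg_left (le_max_right _ _) (inv_nonneg.2 hε.le)).trans (not_lt.1 hn)

lemma ae_isTame_norm (hν : MeasurePreserving shift ν ν)
    (hlog : Integrable (fun x : ℤ → E => Real.posLog ‖x 0‖) ν) {κ : NNReal} (hκ : κ < 1) :
    ∀ᵐ x ∂ν, IsTame κ fun t => ‖x t‖ := by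
  obtain ⟨ε, hεκ, hε⟩ : ∃ ε, κ * Real.exp ε < 1 ∧ 0 < ε := by
    have h_lim : Tendsto (fun ε => κ * Real.exp ε) (𝓝[>] 0) (𝓝 (κ * Real.exp 0)) :=
      ((continuous_const.mul Real.continuous_exp).tendsto 0).mono_left nhdsWithin_le_nhds
    rw [Real.exp_zero, mul_one] at h_lim
    exact ((h_lim.eventually_lt_const (NNReal.coe_lt_one.2 hκ)).and self_mem_nhdsWithin).exists
  filter_upwards [ae_all_iff.2 (ae_eventually_norm_le_exp hν hlog hε)] with x hx t
  refine (summable_geometric_of_lt_one (by positivity) hεκ).of_norm_bounded_eventually_nat ?_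
  filter_upwards [hx t] with n hn
  rw [mul_pow, ← Real.exp_nat_mul, mul_comm (n : ℝ) ε, Real.norm_of_nonneg (by positivity)]
  gcongr

end LogMoment

/-! ### The binary model -/

/-- The link `F` is a Lipschitz function with values in `(0, 1]`, and the feedback `g` contracts by
a factor `κ < 1`. -/
structure IsModel (F g : ℝ → ℝ) (κ : NNReal) : Prop where
  link_mem : ∀ s, F s ∈ Set.Ioc (0 : ℝ) 1
  lipschitz_link : ∃ K, LipschitzWith K F
  rate_lt_one : κ < 1
  contraction : LipschitzWith κ g

section DriveBound

variable {E : Type*} [NormedAddCommGroup E]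

/-- A bound on `g 0 + α * y (t - 1) + ⟪γ, x t⟫` uniform in the responses `y`. -/
def driveBound (g : ℝ → ℝ) (α : ℝ) (γ : E) (x : ℤ → E) (t : ℤ) : ℝ :=
  |g 0| + |α| + ‖γ‖ * ‖x t‖

lemma IsTame.isTame_driveBound {κ : NNReal} {x : ℤ → E} (hx : IsTame κ fun t => ‖x t‖)
    (hκ : κ < 1) (g : ℝ → ℝ) (α : ℝ) (γ : E) : IsTame κ (driveBound g α γ x) :=
  (IsTame.const hκ (|g 0| + |α|)).add (hx.const_mul ‖γ‖)

lemma discounted_driveBound_translate (κ : NNReal) (g : ℝ → ℝ) (α : ℝ) (γ : E) (x : ℤ → E)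
    (s t : ℤ) :
    discounted κ (driveBound g α γ (translate s x)) t =
      discounted κ (driveBound g α γ x) (t + s) :=
  discounted_translate κ (driveBound g α γ x) s t

variable [MeasurableSpace E] [BorelSpace E]

lemma measurable_driveBound (g : ℝ → ℝ) (α : ℝ) (γ : E) :
    Measurable (driveBound g α γ : (ℤ → E) → ℤ → ℝ) :=
  measurable_pi_lambda _ fun t =>
    ((continuous_norm.measurable.comp (measurable_pi_apply t)).const_mul ‖γ‖).const_add _

lemma measurable_discounted_driveBound (κ : NNReal) (g : ℝ → ℝ) (α : ℝ) (γ : E) (t : ℤ) :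
    Measurable fun x : ℤ → E => discounted κ (driveBound g α γ x) t :=
  (measurable_discounted κ t).comp (measurable_driveBound g α γ)

end DriveBound

section Response

variable {E : Type*} [NormedAddCommGroup E] [InnerProductSpace ℝ E]

/-- The sequence driving the recursion of the latent process, for covariates `x` and responses
`y`. -/
noncomputable def drive (α : ℝ) (γ : E) (x : ℤ → E) (y : BinSeq) (t : ℤ) : ℝ :=
  α * isOne (t - 1) y + inner ℝ γ (x t)

/-- The latent process started in the remote past, as a function of the trajectory of covariates and
responses. -/
noncomputable def state (g : ℝ → ℝ) (α : ℝ) (γ : E) (z : (ℤ → E) × BinSeq) (t : ℤ) : ℝ :=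
  latent g (drive α γ z.1 z.2) t

/-- The conditional probability of a success at time `t` given the covariates `x` and the past of
the responses `y`. -/
noncomputable def response (F g : ℝ → ℝ) (α : ℝ) (γ : E) (x : ℤ → E) (t : ℤ) (y : BinSeq) : ℝ :=
  F (state g α γ (x, y) t)

variable {F g : ℝ → ℝ} {κ : NNReal} {x : ℤ → E}

lemma abs_add_drive_le (g : ℝ → ℝ) (α : ℝ) (γ : E) (x : ℤ → E) (y : BinSeq) (t : ℤ) :
    |g 0 + drive α γ x y t| ≤ driveBound g α γ x t := by
  have h_resp : |α * isOne (t - 1) y| ≤ |α| := by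
    rw [abs_mul, abs_of_nonneg (isOne_mem_Icc _ y).1]
    exact mul_le_of_le_one_right (abs_nonneg α) (isOne_mem_Icc _ y).2
  calc |g 0 + drive α γ x y t| ≤ |g 0| + (|α * isOne (t - 1) y| + |inner ℝ γ (x t)|) :=
        (abs_add_le _ _).trans (add_le_add_right (abs_add_le _ _) _)
    _ ≤ |g 0| + (|α| + ‖γ‖ * ‖x t‖) := by
        gcongr
        exact abs_real_inner_le_norm γ (x t)
    _ = driveBound g α γ x t := (add_assoc _ _ _).symm

lemma dependsOn_drive (α : ℝ) (γ : E) (x : ℤ → E) (t : ℤ) :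
    DependsOn (fun y => drive α γ x y t) {t - 1} := fun y y' h => by
  simp only [drive, isOne, h (t - 1) rfl]

lemma continuous_drive (α : ℝ) (γ : E) (x : ℤ → E) : Continuous (drive α γ x) :=
  continuous_pi fun t => ((continuous_isOne (t - 1)).const_mul α).add_const _

lemma drive_shift (α : ℝ) (γ : E) (x : ℤ → E) (y : BinSeq) :
    drive α γ (shift x) (shift y) = shift (drive α γ x y) := by
  funext t
  simp only [drive, isOne, shift, sub_add_cancel, add_sub_cancel_right]

lemma state_shift (g : ℝ → ℝ) (α : ℝ) (γ : E) (z : (ℤ → E) × BinSeq) (t : ℤ) :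
    state g α γ (Prod.map shift shift z) t = state g α γ z (t + 1) := by
  simp only [state, Prod.map_fst, Prod.map_snd, drive_shift, latent_shift]

lemma isEquivariant_response (F g : ℝ → ℝ) (α : ℝ) (γ : E) :
    IsEquivariant (response F g α γ) shift := fun x s y =>
  congrArg F (state_shift g α γ (x, y) s)

lemma IsTame.abs_state_le (hx : IsTame κ fun t => ‖x t‖) (hM : IsModel F g κ) (α : ℝ) (γ : E)
    (y : BinSeq) (t : ℤ) : |state g α γ (x, y) t| ≤ discounted κ (driveBound g α γ x) t :=
  (hx.isTame_driveBound hM.rate_lt_one g α γ).abs_latent_le hM.contraction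
    (abs_add_drive_le g α γ x y) t

lemma IsTame.state_eq (hx : IsTame κ fun t => ‖x t‖) (hM : IsModel F g κ) (α : ℝ) (γ : E)
    (y : BinSeq) (t : ℤ) :
    state g α γ (x, y) t = g (state g α γ (x, y) (t - 1)) + drive α γ x y t :=
  (hx.isTame_driveBound hM.rate_lt_one g α γ).latent_eq hM.contraction
    (abs_add_drive_le g α γ x y) t

lemma IsTame.continuous_response (hx : IsTame κ fun t => ‖x t‖) (hM : IsModel F g κ) (α : ℝ)
    (γ : E) (t : ℤ) : Continuous (response F g α γ x t) :=
  hM.lipschitz_link.choose_spec.continuous.comp <|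
    (hx.isTame_driveBound hM.rate_lt_one g α γ).continuous_latent hM.contraction
      (continuous_drive α γ x) (abs_add_drive_le g α γ x) t

variable [MeasurableSpace E] [BorelSpace E]

lemma measurable_state (hg : Measurable g) (α : ℝ) (γ : E) (t : ℤ) :
    Measurable fun z : (ℤ → E) × BinSeq => state g α γ z t := by
  refine measurable_latent hg (measurable_pi_lambda _ fun s => ?_) t
  exact (((continuous_isOne (s - 1)).measurable.comp measurable_snd).const_mul α).add
    ((continuous_const.inner continuous_id).measurable.comp
      ((measurable_pi_apply s).comp measurable_fst))

namespace IsModel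

lemma isSpecification_response (hM : IsModel F g κ) (α : ℝ) (γ : E) :
    IsSpecification (response F g α γ) where
  mem_Icc x t y := Set.Ioc_subset_Icc_self (hM.link_mem _)
  measurable t := hM.lipschitz_link.choose_spec.continuous.measurable.comp
    (measurable_state hM.contraction.continuous.measurable α γ t)
  dependsOn x t y y' h := congrArg F <| latent_congr g fun i hi =>
    dependsOn_drive α γ x i fun s hs => h s <| by
      rw [Set.mem_singleton_iff.1 hs]
      exact (sub_one_lt i).trans_le hi

lemma ae_forgets_response (hM : IsModel F g κ) (α : ℝ) (γ : E) {ν : Measure (ℤ → E)}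
    [IsFiniteMeasure ν] (hν : MeasurePreserving shift ν ν)
    (hT : ∀ᵐ x ∂ν, IsTame κ fun t => ‖x t‖) : ∀ᵐ x ∂ν, Forgets (response F g α γ x) := by
  obtain ⟨K, hK⟩ := hM.lipschitz_link
  have h_rec := ae_isRecurrentlyBounded hν (measurable_discounted_driveBound κ g α γ 0)
  filter_upwards [hT, h_rec] with x hx hx_rec
  refine (hx.isTame_driveBound hM.rate_lt_one g α γ).forgets hK hM.link_mem hM.contraction
    hM.rate_lt_one (abs_add_drive_le g α γ x) (dependsOn_drive α γ x) ?_
  simpa only [discounted_driveBound_translate, zero_add] using hx_rec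

end IsModel

end Response

section Paths

variable {Ω S : Type*}

/-- The trajectories of a pair of processes. -/
def paths (X : ℤ → Ω → S) (Y : ℤ → Ω → Fin 2) (ω : Ω) : (ℤ → S) × BinSeq :=
  (fun t => X t ω, fun t => Y t ω)

lemma isOne_paths_eq_indicator (X : ℤ → Ω → S) (Y : ℤ → Ω → Fin 2) (t : ℤ) :
    (fun ω => isOne t (paths X Y ω).2) = (Y t ⁻¹' {1}).indicator (fun _ => (1 : ℝ)) := by
  funext ω
  obtain h | h : Y t ω = 0 ∨ Y t ω = 1 := by omega
  all_goals simp [isOne, paths, Set.indicator, h]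

variable [MeasurableSpace S]

lemma info_eq_comap_paths (X : ℤ → Ω → S) (Y : ℤ → Ω → Fin 2) (t : ℤ) :
    info X Y t = (pastAlgebra (ℤ → S) t).comap (paths X Y) := by
  refine le_antisymm (sup_le (iSup_le fun s => ?_) (iSup_le fun s => ?_)) ?_
  · exact Measurable.comap_le <| (measurable_pastAlgebra
      ((measurable_pi_apply (s : ℤ)).comp measurable_snd) fun _ _ _ h => h s s.2).comp
        (comap_measurable (paths X Y))
  · exact Measurable.comap_le <| ((measurable_pi_apply s).comp
      (measurable_fst_pastAlgebra t)).comp (comap_measurable (paths X Y))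
  · have hX (s : ℤ) : Measurable[info X Y t] (X s) := Measurable.of_comap_le <|
      le_sup_of_le_right (le_iSup (fun s => MeasurableSpace.comap (X s) inferInstance) s)
    have hY (s : ℤ) (hs : s < t) : Measurable[info X Y t] (Y s) := Measurable.of_comap_le <|
      le_sup_of_le_left (le_iSup (fun s : {s // s < t} =>
        MeasurableSpace.comap (Y s) inferInstance) ⟨s, hs⟩)
    rw [MeasurableSpace.comap_comp]
    let _ : MeasurableSpace Ω := info X Y t
    refine ((measurable_pi_lambda _ hX).prodMk (measurable_pi_lambda _ fun s => ?_)).comap_le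
    by_cases hs : s < t
    · simpa only [past, hs, if_true] using hY s hs
    · simpa only [past, hs, if_false] using measurable_const

variable [MeasurableSpace Ω] {X : ℤ → Ω → S} {Y : ℤ → Ω → Fin 2}

lemma measurable_paths (hX : ∀ t, Measurable (X t)) (hY : ∀ t, Measurable (Y t)) :
    Measurable (paths X Y) :=
  (measurable_pi_lambda _ hX).prodMk (measurable_pi_lambda _ hY)

lemma info_le (hX : ∀ t, Measurable (X t)) (hY : ∀ t, Measurable (Y t)) (t : ℤ) :
    info X Y t ≤ (inferInstance : MeasurableSpace Ω) :=
  sup_le (iSup_le fun s => (hY s).comap_le) (iSup_le fun s => (hX s).comap_le)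

variable {P : Measure Ω} [IsFiniteMeasure P]

lemma integrable_isOne_paths (hX : ∀ t, Measurable (X t)) (hY : ∀ t, Measurable (Y t)) (t : ℤ) :
    Integrable (fun ω => isOne t (paths X Y ω).2) P :=
  .of_mem_Icc 0 1
    ((continuous_isOne t).measurable.comp (measurable_paths hX hY).snd).aemeasurable
    (.of_forall fun _ => isOne_mem_Icc _ _)

lemma IsSpecification.integrable_paths {p : (ℤ → S) → ℤ → BinSeq → ℝ} (hp : IsSpecification p)
    (hX : ∀ t, Measurable (X t)) (hY : ∀ t, Measurable (Y t)) (t : ℤ) :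
    Integrable (fun ω => p (paths X Y ω).1 t (paths X Y ω).2) P :=
  .of_mem_Icc 0 1 ((hp.measurable t).comp (measurable_paths hX hY)).aemeasurable
    (.of_forall fun _ => hp.mem_Icc _ _ _)

lemma IsSpecification.setIntegral_innovation_map_paths {p : (ℤ → S) → ℤ → BinSeq → ℝ}
    (hp : IsSpecification p) (hX : ∀ t, Measurable (X t)) (hY : ∀ t, Measurable (Y t)) {t : ℤ}
    {C : Set ((ℤ → S) × BinSeq)} (hC : MeasurableSet[pastAlgebra (ℤ → S) t] C) :
    ∫ z in C, innovation p t z ∂P.map (paths X Y) =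
      ∫ ω in paths X Y ⁻¹' C, isOne t (paths X Y ω).2 ∂P -
        ∫ ω in paths X Y ⁻¹' C, p (paths X Y ω).1 t (paths X Y ω).2 ∂P := by
  rw [setIntegral_map (pastAlgebra_le t _ hC) (hp.measurable_innovation t).aestronglyMeasurable
    (measurable_paths hX hY).aemeasurable]
  exact integral_sub (integrable_isOne_paths hX hY t).integrableOn
    (hp.integrable_paths hX hY t).integrableOn

lemma IsCompatible.condExp_ae_eq {p : (ℤ → S) → ℤ → BinSeq → ℝ}
    (hρ : IsCompatible p (P.map (paths X Y))) (hp : IsSpecification p)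
    (hX : ∀ t, Measurable (X t)) (hY : ∀ t, Measurable (Y t)) (t : ℤ) :
    P[(Y t ⁻¹' {1}).indicator (fun _ => (1 : ℝ)) | info X Y t]
      =ᵐ[P] fun ω => p (paths X Y ω).1 t (paths X Y ω).2 := by
  rw [← isOne_paths_eq_indicator X Y t]
  refine (ae_eq_condExp_of_forall_setIntegral_eq (info_le hX hY t)
    (integrable_isOne_paths hX hY t) (fun _ _ _ => (hp.integrable_paths hX hY t).integrableOn)
    (fun A hA _ => ?_) ?_).symm
  · rw [info_eq_comap_paths] at hA
    obtain ⟨C, hC, rfl⟩ := hA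
    exact (sub_eq_zero.1 ((hp.setIntegral_innovation_map_paths hX hY hC).symm.trans
      (hρ t C hC))).symm
  · rw [info_eq_comap_paths]
    exact ((measurable_pastAlgebra (hp.measurable t) fun x => hp.dependsOn x t).comp
      (comap_measurable _)).aestronglyMeasurable

end Paths

/-! ### Solutions of the model -/

section IdentDistrib

variable {Ω : Type*} [MeasurableSpace Ω] {P : Measure Ω}

lemma identDistrib_comp_translate {E : Type*} [MeasurableSpace E] {Z : ℤ → Ω → E}
    (hZ : ∀ t, Measurable (Z t)) (h : MeasurePreserving shift (pathLaw Z P) (pathLaw Z P))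
    {f : (ℤ → E) → ℝ} (hf : Measurable f) (s s' : ℤ) :
    IdentDistrib (fun ω => f (translate s fun t => Z t ω))
      (fun ω => f (translate s' fun t => Z t ω)) P P := by
  have h_path : Measurable fun ω t => Z t ω := measurable_pi_lambda _ hZ
  have h_map (s : ℤ) : P.map (fun ω => translate s fun t => Z t ω) = pathLaw Z P := by
    rw [← (measurePreserving_translate h s).map_eq, pathLaw,
      Measure.map_map (measurable_translate s) h_path]
    rfl
  have h_meas (s : ℤ) : AEMeasurable (fun ω => translate s fun t => Z t ω) P :=
    ((measurable_translate s).comp h_path).aemeasurable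
  exact (IdentDistrib.mk (h_meas s) (h_meas s') ((h_map s).trans (h_map s').symm)).comp hf

variable [IsFiniteMeasure P] {c : ℝ} {A B : ℕ → Ω → ℝ}

lemma tendstoInMeasure_pow_mul (hc₀ : 0 ≤ c) (hc₁ : c < 1)
    (hA : ∀ n, IdentDistrib (A n) (A 0) P P) :
    TendstoInMeasure P (fun n ω => c ^ n * A n ω) atTop 0 := by
  have h₀ : TendstoInMeasure P (fun n ω => c ^ n * A 0 ω) atTop 0 := by
    refine tendstoInMeasure_of_tendsto_ae
      (fun n => ((hA 0).aemeasurable_fst.const_mul _).aestronglyMeasurable) (.of_forall fun ω => ?_)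
    simpa only [zero_mul, Pi.zero_apply] using
      (tendsto_pow_atTop_nhds_zero_of_lt_one hc₀ hc₁).mul_const (A 0 ω)
  intro ε hε
  refine (h₀ ε hε).congr fun n => ?_
  exact (((hA n).comp (measurable_id.const_mul (c ^ n))).measure_mem_eq
    (s := {a | ε ≤ edist a 0}) (measurableSet_le measurable_const
      (measurable_id.edist measurable_const))).symm

lemma ae_eq_of_abs_sub_le_pow_mul {u v : Ω → ℝ} (hc₀ : 0 ≤ c) (hc₁ : c < 1)
    (hA : ∀ n, IdentDistrib (A n) (A 0) P P) (hB : ∀ n, IdentDistrib (B n) (B 0) P P)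
    (h : ∀ᵐ ω ∂P, ∀ n, |u ω - v ω| ≤ c ^ n * (A n ω + B n ω)) : u =ᵐ[P] v := by
  obtain ⟨i, hi, hiA⟩ := (tendstoInMeasure_pow_mul hc₀ hc₁ hA).exists_seq_tendsto_ae
  obtain ⟨j, hj, hijB⟩ :=
    ((tendstoInMeasure_pow_mul hc₀ hc₁ hB).comp hi.tendsto_atTop).exists_seq_tendsto_ae
  filter_upwards [h, hiA, hijB] with ω hω hωA hωB
  have h_lim := (hωA.comp hj.tendsto_atTop).add hωB
  simp only [Pi.zero_apply, add_zero] at h_lim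
  refine sub_eq_zero.1 (abs_nonpos_iff.1 (ge_of_tendsto' h_lim fun n => ?_))
  exact (hω (i (j n))).trans_eq (mul_add _ _ _)

end IdentDistrib

section Solution

variable {d : ℕ} {F g : ℝ → ℝ} {κ : NNReal} {α : ℝ} {γ : EuclideanSpace ℝ (Fin d)}
  {Ω : Type*} [MeasurableSpace Ω] {P : Measure Ω}
  {X : ℤ → Ω → EuclideanSpace ℝ (Fin d)} {Y : ℤ → Ω → Fin 2} {lam : ℤ → Ω → ℝ}

namespace IsSolution

lemma integrable_link (h : IsSolution F g α γ P X Y lam) (t : ℤ) :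
    Integrable (fun ω => F (lam t ω)) P :=
  integrable_condExp.congr (h.cond_prob t)

lemma ae_abs_sub_state_le (h : IsSolution F g α γ P X Y lam) (hM : IsModel F g κ)
    (hT : ∀ᵐ ω ∂P, IsTame κ fun t => ‖X t ω‖) :
    ∀ᵐ ω ∂P, ∀ (s : ℤ) (n : ℕ), |lam (s + n) ω - state g α γ (paths X Y ω) (s + n)| ≤
      κ ^ n * |lam s ω - state g α γ (paths X Y ω) s| := by
  filter_upwards [hT, ae_all_iff.2 h.recursion] with ω hω h_rec s n
  refine abs_sub_le_pow_mul hM.contraction (l := fun t => lam t ω)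
    (l' := state g α γ (paths X Y ω)) n fun t _ _ => ?_
  have h_state : state g α γ (paths X Y ω) t =
      g (state g α γ (paths X Y ω) (t - 1)) + drive α γ _ _ t := hω.state_eq hM α γ _ t
  rw [h_state, h_rec t, add_assoc, add_sub_cancel_left, add_sub_cancel_left]
  rfl

lemma ae_eq_state_of_isStationary [IsFiniteMeasure P] (h : IsSolution F g α γ P X Y lam)
    (hM : IsModel F g κ) (hT : ∀ᵐ ω ∂P, IsTame κ fun t => ‖X t ω‖)
    (hX : MeasurePreserving shift (pathLaw X P) (pathLaw X P)) (h_lam : IsStationary lam P)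
    (t : ℤ) : lam t =ᵐ[P] fun ω => state g α γ (paths X Y ω) t := by
  have h_lam_ident (n : ℕ) :=
    identDistrib_comp_translate h.measurable_lam h_lam.invariant
      (f := fun l => |l 0|) (measurable_pi_apply 0).abs (t - n) (t - (0 : ℕ))
  have h_bound_ident (n : ℕ) :=
    identDistrib_comp_translate h.measurable_X hX
      (measurable_discounted_driveBound κ g α γ 0) (t - n) (t - (0 : ℕ))
  refine ae_eq_of_abs_sub_le_pow_mul κ.coe_nonneg (NNReal.coe_lt_one.2 hM.rate_lt_one)
    h_lam_ident h_bound_ident ?_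
  filter_upwards [hT, h.ae_abs_sub_state_le hM hT] with ω hω h_track n
  rw [discounted_driveBound_translate, translate, zero_add]
  refine (sub_add_cancel t (n : ℤ) ▸ h_track (t - n) n).trans ?_
  gcongr
  exact (abs_sub _ _).trans (add_le_add_right (hω.abs_state_le hM α γ _ _) _)

variable [IsFiniteMeasure P]

lemma setIntegral_innovation (h : IsSolution F g α γ P X Y lam)
    {p : (ℤ → EuclideanSpace ℝ (Fin d)) → ℤ → BinSeq → ℝ} (hp : IsSpecification p) {t : ℤ}
    {C : Set ((ℤ → EuclideanSpace ℝ (Fin d)) × BinSeq)} (hC : MeasurableSet[pastAlgebra _ t] C) :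
    ∫ z in C, innovation p t z ∂P.map (paths X Y) =
      ∫ ω in paths X Y ⁻¹' C, (F (lam t ω) - p (paths X Y ω).1 t (paths X Y ω).2) ∂P := by
  have h_info := info_le h.measurable_X h.measurable_Y t
  have hC' : MeasurableSet[info X Y t] (paths X Y ⁻¹' C) := by
    rw [info_eq_comap_paths]
    exact ⟨C, hC, rfl⟩
  have h_link : ∫ ω in paths X Y ⁻¹' C, isOne t (paths X Y ω).2 ∂P =
      ∫ ω in paths X Y ⁻¹' C, F (lam t ω) ∂P := by
    rw [← setIntegral_condExp h_info (integrable_isOne_paths h.measurable_X h.measurable_Y t) hC',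
      isOne_paths_eq_indicator]
    exact setIntegral_congr_ae (h_info _ hC') ((h.cond_prob t).mono fun _ e _ => e)
  rw [hp.setIntegral_innovation_map_paths h.measurable_X h.measurable_Y hC, h_link]
  exact (integral_sub (h.integrable_link t).integrableOn
    (hp.integrable_paths h.measurable_X h.measurable_Y t).integrableOn).symm

lemma isCompatible_of_ae_eq_state (h : IsSolution F g α γ P X Y lam) (hM : IsModel F g κ)
    (h_lam : ∀ t, lam t =ᵐ[P] fun ω => state g α γ (paths X Y ω) t) :
    IsCompatible (response F g α γ) (P.map (paths X Y)) := by
  intro t C hC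
  rw [h.setIntegral_innovation (hM.isSpecification_response α γ) hC]
  refine integral_eq_zero_of_ae (ae_restrict_of_ae ?_)
  filter_upwards [h_lam t] with ω hω
  exact sub_eq_zero.2 (congrArg F hω)

lemma tendsto_integral_abs_sub_response (h : IsSolution F g α γ P X Y lam) (hM : IsModel F g κ)
    (hT : ∀ᵐ ω ∂P, IsTame κ fun t => ‖X t ω‖) (s : ℤ) :
    Tendsto (fun n : ℕ => ∫ ω, |F (lam (s + n) ω) -
      response F g α γ (paths X Y ω).1 (s + n) (paths X Y ω).2| ∂P) atTop (𝓝 0) := by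
  obtain ⟨K, hK⟩ := hM.lipschitz_link
  rw [← integral_zero Ω ℝ (μ := P)]
  refine tendsto_integral_filter_of_norm_le_const (.of_forall fun n => ?_)
    ⟨1, .of_forall fun n => .of_forall fun ω => ?_⟩ ?_
  · exact ((h.integrable_link _).sub ((hM.isSpecification_response α γ).integrable_paths
      h.measurable_X h.measurable_Y _)).abs.aestronglyMeasurable
  · rw [Real.norm_eq_abs, abs_abs]
    exact abs_sub_le_of_nonneg_of_le (hM.link_mem _).1.le (hM.link_mem _).2
      (hM.link_mem _).1.le (hM.link_mem _).2
  filter_upwards [h.ae_abs_sub_state_le hM hT] with ω h_track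
  have h_lim := ((tendsto_pow_atTop_nhds_zero_of_lt_one κ.coe_nonneg
    (NNReal.coe_lt_one.2 hM.rate_lt_one)).mul_const
      |lam s ω - state g α γ (paths X Y ω) s|).const_mul (K : ℝ)
  rw [zero_mul, mul_zero] at h_lim
  exact squeeze_zero (fun n => abs_nonneg _) (fun n => (hK.dist_le_mul _ _).trans
    (mul_le_mul_of_nonneg_left (h_track s n) K.coe_nonneg)) h_lim

/-- Stationarity moves an event of the past arbitrarily far to the right, where the memory of the
initial value of the latent process is lost. -/
lemma isCompatible_of_measurePreserving (h : IsSolution F g α γ P X Y lam) (hM : IsModel F g κ)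
    (hT : ∀ᵐ ω ∂P, IsTame κ fun t => ‖X t ω‖)
    (h_inv : MeasurePreserving (Prod.map shift shift) (P.map (paths X Y)) (P.map (paths X Y))) :
    IsCompatible (response F g α γ) (P.map (paths X Y)) := by
  have hp := hM.isSpecification_response α γ
  intro s C hC
  refine abs_nonpos_iff.1 (ge_of_tendsto' (h.tendsto_integral_abs_sub_response hM hT s) fun n => ?_)
  obtain ⟨D, hD, hCD⟩ := (isEquivariant_response F g α γ).exists_setIntegral_innovation_eq hp
    measurable_shift h_inv hC n
  rw [hCD, h.setIntegral_innovation hp hD]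
  exact abs_integral_le_integral_abs.trans (setIntegral_le_integral
    ((h.integrable_link _).sub (hp.integrable_paths h.measurable_X h.measurable_Y _)).abs
    (.of_forall fun ω => abs_nonneg _))

end IsSolution

lemma IsCompatible.isSolution [IsFiniteMeasure P]
    (hρ : IsCompatible (response F g α γ) (P.map (paths X Y))) (hM : IsModel F g κ)
    (hX : ∀ t, Measurable (X t)) (hY : ∀ t, Measurable (Y t))
    (hT : ∀ᵐ ω ∂P, IsTame κ fun t => ‖X t ω‖) :
    IsSolution F g α γ P X Y fun t ω => state g α γ (paths X Y ω) t where
  measurable_X := hX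
  measurable_Y := hY
  measurable_lam t :=
    (measurable_state hM.contraction.continuous.measurable α γ t).comp (measurable_paths hX hY)
  cond_prob t := hρ.condExp_ae_eq (hM.isSpecification_response α γ) hX hY t
  recursion t := by
    filter_upwards [hT] with ω hω
    exact (hω.state_eq hM α γ _ t).trans (add_assoc _ _ _).symm

end Solution

/-! ### Laws of the trajectories -/

lemma map_compProd_comap {Ω S T : Type*} [MeasurableSpace Ω] [MeasurableSpace S]
    [MeasurableSpace T] {P : Measure Ω} [SFinite P] {u : Ω → S} (hu : Measurable u)
    (η : Kernel S T) [IsSFiniteKernel η] :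
    (P ⊗ₘ η.comap u hu).map (Prod.map u id) = P.map u ⊗ₘ η := by
  have hm : Measurable (Prod.map u (id : T → T)) := hu.prodMap measurable_id
  ext B hB
  rw [Measure.map_apply hm hB, Measure.compProd_apply (hm hB), Measure.compProd_apply hB,
    lintegral_map (Kernel.measurable_kernel_prodMk_left hB) hu]
  rfl

lemma pathLaw_map {Ω Ω' S : Type*} [MeasurableSpace Ω] [MeasurableSpace Ω'] [MeasurableSpace S]
    {P : Measure Ω} {u : Ω → Ω'} {Z : ℤ → Ω' → S} (hZ : ∀ t, Measurable (Z t))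
    (hu : Measurable u) : pathLaw Z (P.map u) = pathLaw (fun t ω => Z t (u ω)) P :=
  Measure.map_map (measurable_pi_lambda _ hZ) hu

instance isFiniteMeasure_pathLaw {Ω S : Type*} [MeasurableSpace Ω] [MeasurableSpace S]
    (Z : ℤ → Ω → S) (P : Measure Ω) [IsFiniteMeasure P] : IsFiniteMeasure (pathLaw Z P) :=
  Measure.isFiniteMeasure_map P _

section Trajectories

variable {Ω S : Type*} [MeasurableSpace Ω] [MeasurableSpace S] {P : Measure Ω}
  {X : ℤ → Ω → S} {Y : ℤ → Ω → Fin 2}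

lemma map_fst_map_paths (hX : ∀ t, Measurable (X t)) (hY : ∀ t, Measurable (Y t)) :
    (P.map (paths X Y)).map Prod.fst = pathLaw X P := by
  rw [Measure.map_map measurable_fst (measurable_paths hX hY)]
  rfl

lemma measurePreserving_arrowProdEquivProdArrow (hX : ∀ t, Measurable (X t))
    (hY : ∀ t, Measurable (Y t)) :
    MeasurePreserving (MeasurableEquiv.arrowProdEquivProdArrow S (Fin 2) ℤ)
      (pathLaw (fun t ω => (X t ω, Y t ω)) P) (P.map (paths X Y)) := by
  refine ⟨MeasurableEquiv.measurable _, ?_⟩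
  rw [pathLaw, Measure.map_map (MeasurableEquiv.measurable _)
    (measurable_pi_lambda _ fun t => (hX t).prodMk (hY t))]
  rfl

lemma IsStationary.measurePreserving_paths (h : IsStationary (fun t ω => (X t ω, Y t ω)) P) :
    MeasurePreserving (Prod.map shift shift) (P.map (paths X Y)) (P.map (paths X Y)) :=
  (measurePreserving_arrowProdEquivProdArrow (fun t => (h.measurable t).fst)
    fun t => (h.measurable t).snd).of_semiconj h.invariant (fun _ => rfl)
      (measurable_shift.prodMap measurable_shift)

lemma isStationaryErgodic_of_ergodic_paths (hX : ∀ t, Measurable (X t))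
    (hY : ∀ t, Measurable (Y t)) (h : Ergodic (Prod.map shift shift) (P.map (paths X Y))) :
    IsStationaryErgodic (fun t ω => (X t ω, Y t ω)) P where
  measurable t := (hX t).prodMk (hY t)
  ergodic := (measurePreserving_arrowProdEquivProdArrow hX hY).symm.ergodic_of_ergodic_semiconj h
    measurable_shift fun _ => rfl

lemma exists_measure_map_paths_eq [IsProbabilityMeasure P] (hX : ∀ t, Measurable (X t))
    (η : Kernel (ℤ → S) BinSeq) [IsMarkovKernel η] :
    ∃ Q : Measure (BinSeq × Ω), IsProbabilityMeasure Q ∧ Q.map Prod.snd = P ∧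
      Q.map (paths (fun t q => X t q.2) fun t q => q.1 t) = pathLaw X P ⊗ₘ η := by
  have h_path : Measurable fun ω t => X t ω := measurable_pi_lambda _ hX
  refine ⟨(P ⊗ₘ η.comap _ h_path).map Prod.swap,
    Measure.isProbabilityMeasure_map measurable_swap.aemeasurable, ?_, ?_⟩
  · rw [Measure.map_map measurable_snd measurable_swap]
    exact Measure.fst_compProd P _
  · have h_paths : Measurable (paths (fun t (q : BinSeq × Ω) => X t q.2) fun t q => q.1 t) :=
      measurable_paths (fun t => (hX t).comp measurable_snd)
        fun t => (measurable_pi_apply t).comp measurable_fst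
    rw [Measure.map_map h_paths measurable_swap]
    exact map_compProd_comap h_path η

lemma IsCompatible.pathLaw_eq {Ω' : Type*} [MeasurableSpace Ω'] {P' : Measure Ω'}
    [IsFiniteMeasure P] [IsFiniteMeasure P'] {X' : ℤ → Ω' → S} {Y' : ℤ → Ω' → Fin 2}
    {p : (ℤ → S) → ℤ → BinSeq → ℝ} (hρ : IsCompatible p (P.map (paths X Y)))
    (hρ' : IsCompatible p (P'.map (paths X' Y'))) (hp : IsSpecification p)
    (hF : ∀ᵐ x ∂pathLaw X P, Forgets (p x))
    (hX : ∀ t, Measurable (X t)) (hY : ∀ t, Measurable (Y t))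
    (hX' : ∀ t, Measurable (X' t)) (hY' : ∀ t, Measurable (Y' t))
    (h_law : pathLaw X' P' = pathLaw X P) :
    pathLaw (fun t ω => (X' t ω, Y' t ω)) P' = pathLaw (fun t ω => (X t ω, Y t ω)) P := by
  have h_paths : P'.map (paths X' Y') = P.map (paths X Y) := by
    refine hρ.eq_of_map_fst_eq hρ' hp ?_ ?_
    · rwa [map_fst_map_paths hX hY]
    · rw [map_fst_map_paths hX hY, map_fst_map_paths hX' hY', h_law]
  rw [← (measurePreserving_arrowProdEquivProdArrow hX' hY').symm.map_eq, h_paths,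
    (measurePreserving_arrowProdEquivProdArrow hX hY).symm.map_eq]

end Trajectories

section Stationary

variable {d : ℕ} {F g : ℝ → ℝ} {κ : NNReal} {α : ℝ} {γ : EuclideanSpace ℝ (Fin d)}
  {Ω : Type*} [MeasurableSpace Ω] {P : Measure Ω} {X : ℤ → Ω → EuclideanSpace ℝ (Fin d)}
  {Y : ℤ → Ω → Fin 2} {lam : ℤ → Ω → ℝ}

lemma IsStationaryErgodic.ae_isTame_norm [IsProbabilityMeasure P] (hX : IsStationaryErgodic X P)
    (hlog : Integrable (fun ω => Real.posLog ‖X 0 ω‖) P) (hκ : κ < 1) :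
    ∀ᵐ x ∂pathLaw X P, IsTame κ fun t => ‖x t‖ := by
  have h_path : Measurable fun ω t => X t ω := measurable_pi_lambda _ hX.measurable
  have : IsProbabilityMeasure (pathLaw X P) :=
    Measure.isProbabilityMeasure_map h_path.aemeasurable
  refine BinaryAR.ae_isTame_norm hX.ergodic.toMeasurePreserving
    ((integrable_map_measure ?_ h_path.aemeasurable).2 hlog) hκ
  exact ((Real.continuous_posLog.comp continuous_norm).measurable.comp
    (measurable_pi_apply 0)).aestronglyMeasurable

lemma isStationary_state (hM : IsModel F g κ) (hX : ∀ t, Measurable (X t))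
    (hY : ∀ t, Measurable (Y t))
    (h : MeasurePreserving (Prod.map shift shift) (P.map (paths X Y)) (P.map (paths X Y))) :
    IsStationary (fun t ω => (X t ω, Y t ω, state g α γ (paths X Y ω) t)) P := by
  let f (z : (ℤ → EuclideanSpace ℝ (Fin d)) × BinSeq) (t : ℤ) := (z.1 t, z.2 t, state g α γ z t)
  have hf (t : ℤ) : Measurable fun z => f z t :=
    ((measurable_pi_apply t).comp measurable_fst).prodMk
      (((measurable_pi_apply t).comp measurable_snd).prodMk
        (measurable_state hM.contraction.continuous.measurable α γ t))
  have h_law : MeasurePreserving f (P.map (paths X Y))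
      (pathLaw (fun t ω => f (paths X Y ω) t) P) :=
    ⟨measurable_pi_lambda _ hf,
      Measure.map_map (measurable_pi_lambda _ hf) (measurable_paths hX hY)⟩
  refine ⟨fun t => (hf t).comp (measurable_paths hX hY), h_law.of_semiconj h (fun z => ?_)
    measurable_shift⟩
  funext t
  exact congrArg (fun l => (z.1 (t + 1), z.2 (t + 1), l)) (state_shift g α γ z t)

lemma IsSolution.isCompatible [IsFiniteMeasure P] (h : IsSolution F g α γ P X Y lam)
    (hM : IsModel F g κ) (hX : MeasurePreserving shift (pathLaw X P) (pathLaw X P))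
    (hT : ∀ᵐ x ∂pathLaw X P, IsTame κ fun t => ‖x t‖)
    (h_stat : IsStationary (fun t ω => (X t ω, Y t ω)) P ∨ IsStationary lam P) :
    IsCompatible (response F g α γ) (P.map (paths X Y)) := by
  have hT' : ∀ᵐ ω ∂P, IsTame κ fun t => ‖X t ω‖ :=
    ae_of_ae_map (measurable_pi_lambda _ h.measurable_X).aemeasurable hT
  rcases h_stat with h_pair | h_lam
  · exact h.isCompatible_of_measurePreserving hM hT' h_pair.measurePreserving_paths
  · exact h.isCompatible_of_ae_eq_state hM (h.ae_eq_state_of_isStationary hM hT' hX h_lam)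

lemma IsModel.exists_isCompatible [IsProbabilityMeasure P] (hM : IsModel F g κ) (α : ℝ)
    (γ : EuclideanSpace ℝ (Fin d)) (hX : ∀ t, Measurable (X t))
    (hX_inv : MeasurePreserving shift (pathLaw X P) (pathLaw X P))
    (hT : ∀ᵐ x ∂pathLaw X P, IsTame κ fun t => ‖x t‖) :
    ∃ Q : Measure (BinSeq × Ω), IsProbabilityMeasure Q ∧ Q.map Prod.snd = P ∧
      IsCompatible (response F g α γ) (Q.map (paths (fun t q => X t q.2) fun t q => q.1 t)) := by
  obtain ⟨η, hη, h_comp⟩ := exists_kernel_isCompatible (hM.isSpecification_response α γ)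
    (pathLaw X P) (hT.mono fun x hx => hx.continuous_response hM α γ)
    (hM.ae_forgets_response α γ hX_inv hT)
  obtain ⟨Q, hQ, hQ_snd, hQ_paths⟩ := exists_measure_map_paths_eq hX η (P := P)
  exact ⟨Q, hQ, hQ_snd, hQ_paths ▸ h_comp⟩

lemma IsCompatible.ergodic_paths [IsProbabilityMeasure P]
    (hρ : IsCompatible (response F g α γ) (P.map (paths X Y))) (hM : IsModel F g κ)
    (hX : ∀ t, Measurable (X t)) (hY : ∀ t, Measurable (Y t))
    (hX_erg : Ergodic shift (pathLaw X P))
    (hT : ∀ᵐ x ∂pathLaw X P, IsTame κ fun t => ‖x t‖) :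
    Ergodic (Prod.map shift shift) (P.map (paths X Y)) := by
  have : IsProbabilityMeasure (P.map (paths X Y)) :=
    Measure.isProbabilityMeasure_map (measurable_paths hX hY).aemeasurable
  rw [← map_fst_map_paths hX hY] at hX_erg hT
  exact hρ.ergodic (hM.isSpecification_response α γ) (isEquivariant_response F g α γ)
    (hM.ae_forgets_response α γ hX_erg.toMeasurePreserving hT) hX_erg

end Stationary

end BinaryAR

theorem proposition3_general {d : ℕ} {Ω : Type*} [MeasurableSpace Ω]
    (P : Measure Ω) [IsProbabilityMeasure P]
    (F g : ℝ → ℝ) (α : ℝ) (γ : EuclideanSpace ℝ (Fin d))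
    (X : ℤ → Ω → EuclideanSpace ℝ (Fin d))
    (hF : ∀ s, F s ∈ Set.Ioc (0 : ℝ) 1) (hFlip : ∃ K, LipschitzWith K F)
    (κ : NNReal) (hκ : κ < 1) (hg : LipschitzWith κ g)
    (hX : BinaryAR.IsStationaryErgodic X P)
    (hXlog : Integrable (fun ω => Real.posLog ‖X 0 ω‖) P) :
    ∃ (Q : Measure ((ℤ → Fin 2) × Ω)) (lam : ℤ → (ℤ → Fin 2) × Ω → ℝ),
      IsProbabilityMeasure Q ∧
      Q.map Prod.snd = P ∧
      BinaryAR.IsSolution F g α γ Q (fun t p => X t p.2) (fun t p => p.1 t) lam ∧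
      BinaryAR.IsStationary (fun t p => (X t p.2, p.1 t, lam t p)) Q ∧
      BinaryAR.IsStationaryErgodic (fun t p => (X t p.2, p.1 t)) Q ∧
      ∀ {Ω' : Type*} [MeasurableSpace Ω'] (P' : Measure Ω') [IsProbabilityMeasure P']
        (X' : ℤ → Ω' → EuclideanSpace ℝ (Fin d)) (Y' : ℤ → Ω' → Fin 2) (lam' : ℤ → Ω' → ℝ),
        BinaryAR.pathLaw X' P' = BinaryAR.pathLaw X P →
        BinaryAR.IsSolution F g α γ P' X' Y' lam' →
        (BinaryAR.IsStationary (fun t ω => (X' t ω, Y' t ω)) P' ∨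
          BinaryAR.IsStationary lam' P') →
        BinaryAR.pathLaw (fun t ω => (X' t ω, Y' t ω)) P' =
          BinaryAR.pathLaw (fun t p => (X t p.2, p.1 t)) Q := by
  open BinaryAR in
  have hM : IsModel F g κ := ⟨hF, hFlip, hκ, hg⟩
  have hT := hX.ae_isTame_norm hXlog hκ
  have hν := hX.ergodic.toMeasurePreserving
  obtain ⟨Q, hQ, hQ_snd, hρ⟩ := hM.exists_isCompatible α γ hX.measurable hν hT
  have h_law : pathLaw (fun t q => X t q.2) Q = pathLaw X P := by
    rw [← pathLaw_map hX.measurable measurable_snd, hQ_snd]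
  have hXm (t : ℤ) : Measurable fun q : BinSeq × Ω => X t q.2 :=
    (hX.measurable t).comp measurable_snd
  have hYm (t : ℤ) : Measurable fun q : BinSeq × Ω => q.1 t :=
    (measurable_pi_apply t).comp measurable_fst
  have h_erg := hρ.ergodic_paths hM hXm hYm (h_law ▸ hX.ergodic) (h_law ▸ hT)
  refine ⟨Q, _, hQ, hQ_snd, hρ.isSolution hM hXm hYm ?_,
    isStationary_state hM hXm hYm h_erg.toMeasurePreserving,
    isStationaryErgodic_of_ergodic_paths hXm hYm h_erg, ?_⟩
  · exact ae_of_ae_map (measurable_pi_lambda _ hXm).aemeasurable (h_law ▸ hT)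
  · intro Ω' _ P' _ X' Y' lam' h_law' h_sol h_stat
    have hρ' := h_sol.isCompatible hM (h_law' ▸ hν) (h_law' ▸ hT) h_stat
    exact hρ.pathLaw_eq hρ' (hM.isSpecification_response α γ)
      (h_law ▸ hM.ae_forgets_response α γ hν hT) hXm hYm h_sol.measurable_X h_sol.measurable_Y
      (h_law'.trans h_law.symm)

theorem proposition3 {d : ℕ} {Ω : Type*} [MeasurableSpace Ω]
    (P : Measure Ω) [IsProbabilityMeasure P]
    (F g : ℝ → ℝ) (α : ℝ) (γ : EuclideanSpace ℝ (Fin d))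
    (X : ℤ → Ω → EuclideanSpace ℝ (Fin d))
    (hF : BinaryAR.IsCDF F) (hFpos : ∀ s, 0 < F s) (hFlip : ∃ K, LipschitzWith K F)
    (κ : ℝ) (hκ₀ : 0 < κ) (hκ₁ : κ < 1) (hg : ∀ s s' : ℝ, |g s - g s'| ≤ κ * |s - s'|)
    (hX : BinaryAR.IsStationaryErgodic X P)
    (hXlog : Integrable (fun ω => Real.posLog ‖X 0 ω‖) P) :
    -- existence, on an enlargement of the probability space that carries the covariates
    ∃ (Q : Measure ((ℤ → Fin 2) × Ω)) (lam : ℤ → (ℤ → Fin 2) × Ω → ℝ),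
      IsProbabilityMeasure Q ∧
      Q.map Prod.snd = P ∧
      BinaryAR.IsSolution F g α γ Q (fun t p => X t p.2) (fun t p => p.1 t) lam ∧
      BinaryAR.IsStationary (fun t p => (X t p.2, p.1 t, lam t p)) Q ∧
      BinaryAR.IsStationaryErgodic (fun t p => (X t p.2, p.1 t)) Q ∧
      -- uniqueness in law of the pair, for a given law of the covariates
      ∀ {Ω' : Type*} [MeasurableSpace Ω'] (P' : Measure Ω') [IsProbabilityMeasure P']
        (X' : ℤ → Ω' → EuclideanSpace ℝ (Fin d)) (Y' : ℤ → Ω' → Fin 2) (lam' : ℤ → Ω' → ℝ),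
        BinaryAR.pathLaw X' P' = BinaryAR.pathLaw X P →
        BinaryAR.IsSolution F g α γ P' X' Y' lam' →
        (BinaryAR.IsStationary (fun t ω => (X' t ω, Y' t ω)) P' ∨
          BinaryAR.IsStationary lam' P') →
        BinaryAR.pathLaw (fun t ω => (X' t ω, Y' t ω)) P' =
          BinaryAR.pathLaw (fun t p => (X t p.2, p.1 t)) Q := by
  obtain ⟨ν, _, hν⟩ := hF
  exact proposition3_general P F g α γ X (fun s => ⟨hFpos s, hν s ▸ cdf_le_one ν s⟩) hFlip
    ⟨κ, hκ₀.le⟩ hκ₁ (LipschitzWith.of_dist_le_mul hg) hX hXlog
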